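/- Let $(\nu,\lambda)$ be admissible, i.e. $0<\nu<1$ and $2\sqrt{\nu}\le\lambda<1+\nu$. Put $$H(x,y)=\lambda^2+2\nu(1-x^2)y\lambda+2x(1-\nu^2y^2)\lambda-\nu^2+\nu(1-\lambda^2-\nu^2)x^2y^2+1,$$ $$y_c=-\frac{\lambda+\sqrt{\lambda^2-4\nu}}{2\nu},\qquad x_*=-\frac{2\lambda\nu}{\lambda^2+\nu^2-1}\quad(\text{if }\lambda^2+\nu^2\neq1),$$ and let $\mathrm{Sing}=\{(x,y)\in[-1,1]\times\mathbb R: H(x,y)=0\}$. Then $$\mathrm{Sing}\cap\{y\notin(-1,1)\}=\gamma_+\cup\gamma_-,$$ where $\gamma_\pm$ are two connected differentiable curves (images of regular $C^\infty$ embeddings of nondegenerate intervals), with $\gamma_-\subset R_-:=[-1,1]\times(-\infty,y_c)$ and $\gamma_+\subset R_+:=[-1,1]\times(1,\infty)$, such that each of $R_-\setminus\gamma_-$ and $R_+\setminus\gamma_+$ has exactly two connected components. Moreover: 1. If $\lambda+\nu<1$, each of $\gamma_\pm$ has positive distance from the lines $x=1$ and $x=-1$, and is an embedded copy of $\mathbb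 R$ along one end of which $x\to0$ and along the other end of which $x\to x_*$; at both ends $y\to+\infty$ for $\gamma_+$ and $y\to-\infty$ for $\gamma_-$. 2. If $\lambda+\nu>1$, each of $\gamma_\pm$ meets the line $x=1$ in exactly one point, has positive distance from the line $x=-1$, and is an embedded copy of a closed half-line along whose infinite end $x\to0$, with $y\to+\infty$ for $\gamma_+$ and $y\to-\infty$ for $\gamma_-$. 3. If $\lambda+\nu=1$, each of $\gamma_\pm$ has positive distance from the line $x=-1$, does not meet the line $x=1$, and is an embedded copy of $\mathbb R$ along one end of which $x\to0$ and along the other end of which $x\to1$; at both ends $y\to+\infty$ for $\gamma_+$ and $y\to-\infty$ for $\gamma_-$. -/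

import Mathlib

open Set Filter Topology
open scoped ContDiff

namespace PomeranskySenkov

noncomputable section

/-- Admissible parameters: `0 < ν < 1` and `2 √ν ≤ λ < 1 + ν` (here `l` stands for `λ`). -/
def Admissible (ν l : ℝ) : Prop :=
  0 < ν ∧ ν < 1 ∧ 2 * √ν ≤ l ∧ l < 1 + ν

/-- The polynomial `H(x,y)` of the Pomeransky–Senkov metric. -/
def H (ν l x y : ℝ) : ℝ :=
  l ^ 2 + 2 * ν * (1 - x ^ 2) * y * l + 2 * x * (1 - ν ^ 2 * y ^ 2) * l - ν ^ 2
    + ν * (-l ^ 2 - ν ^ 2 + 1) * x ^ 2 * y ^ 2 + 1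

/-- The smaller root `y_c` of `ν y² + λ y + 1`. -/
def yc (ν l : ℝ) : ℝ := -(l + √(l ^ 2 - 4 * ν)) / (2 * ν)

/-- The abscissa `x_*`; it is used only when `λ + ν < 1`, where the denominator is negative. -/
def xStar (ν l : ℝ) : ℝ := -(2 * l * ν) / (l ^ 2 + ν ^ 2 - 1)

/-- The singular set: the zeros of `H` with `x ∈ [-1,1]`. -/
def Sing (ν l : ℝ) : Set (ℝ × ℝ) := {p | p.1 ∈ Icc (-1) 1 ∧ H ν l p.1 p.2 = 0}

/-- The region `{y < y_c}` of the strip `x ∈ [-1,1]`. -/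
def lowerRegion (ν l : ℝ) : Set (ℝ × ℝ) := Icc (-1) 1 ×ˢ Iio (yc ν l)

/-- The region `{y > 1}` of the strip `x ∈ [-1,1]`. -/
def upperRegion : Set (ℝ × ℝ) := Icc (-1) 1 ×ˢ Ioi 1

/-- `c`, restricted to `I`, is a smooth regular parametrization of `γ` that is a homeomorphism
of `I` onto `γ`. -/
structure IsCurveParam (I : Set ℝ) (c : ℝ → ℝ × ℝ) (γ : Set (ℝ × ℝ)) : Prop where
  contDiffOn : ContDiffOn ℝ ∞ c I
  regular : ∀ t ∈ I, derivWithin c I t ≠ 0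
  isEmbedding : IsEmbedding (fun t : I => c t)
  image_eq : c '' I = γ

/-- Connected differentiable curves: smoothly embedded nondegenerate intervals. -/
def IsConnectedCurve (γ : Set (ℝ × ℝ)) : Prop :=
  ∃ (I : Set ℝ) (c : ℝ → ℝ × ℝ), I.OrdConnected ∧ I.Nontrivial ∧ IsCurveParam I c γ

/-- `γ` is a smoothly embedded line: along one end `x → a`, along the other end `x → b`, and `y`
tends to infinity along `l` (`l = atBot` or `l = atTop`) at both ends. -/
def AsymptotesToTwoLines (γ : Set (ℝ × ℝ)) (a b : ℝ) (l : Filter ℝ) : Prop :=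
  ∃ c : ℝ → ℝ × ℝ, IsCurveParam univ c γ ∧
    Tendsto c atBot (𝓝 a ×ˢ l) ∧ Tendsto c atTop (𝓝 b ×ˢ l)

/-- `γ` is a smoothly embedded closed half-line: along its only end `x → a`, while `y` tends to
infinity along `l` (`l = atBot` or `l = atTop`). -/
def AsymptotesToOneLine (γ : Set (ℝ × ℝ)) (a : ℝ) (l : Filter ℝ) : Prop :=
  ∃ c : ℝ → ℝ × ℝ, IsCurveParam (Iic 0) c γ ∧ Tendsto c atBot (𝓝 a ×ˢ l)

/-- `γ ⊆ R`, and `R \ γ` has exactly two connected components. -/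
def SeparatesInTwo (γ R : Set (ℝ × ℝ)) : Prop :=
  γ ⊆ R ∧ Nat.card (ConnectedComponents ↥(R \ γ)) = 2

/-- `γ` has positive distance from the vertical line `x = a`. -/
def StaysAwayFrom (γ : Set (ℝ × ℝ)) (a : ℝ) : Prop :=
  ∃ δ > 0, ∀ p ∈ γ, δ ≤ |p.1 - a|

end

end PomeranskySenkov

/-! ### Symmetric form of `H` and the coefficient inequalities. -/

namespace PomeranskySenkov

/-! In the variables `x` and `w = ν y` the polynomial `ν H` is symmetric, and it involves only the
product `P = x w` and the sum `x + w`, the latter linearly. Away from `P = 1`, a zero therefore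
satisfies `x + w = S(P)` with `S = sumOf` rational, so `x` and `w` are the two roots of `T² - S(P) T
+ P`, and `P` is a global coordinate on the zero set.

Write `ν = a b`, `λ = a + b` with `0 < b ≤ a < 1`; then `y = y_c` is the line `w = -a`. Positivity
of `symH` on that line and on parts of `y = ±1` and `x = -1` shows that zeros with `y ≤ -1` have `P
< 1` and `w < -a < x`, and that zeros with `y ≥ 1` have `P > 1` and `y > 1`. The remaining
constraint `x ≤ 1` becomes `(K - L) P² + M + L ≥ 0` (`lower_zero_iff`, `upper_zero_iff`). Since `K -
L = (1 - (λ + ν)) (1 + (λ + ν))`, it is vacuous when `λ + ν ≤ 1`, and bounds `|P|` by some `B > 1`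
when `λ + ν > 1`, the value `|P| = B` being the point on `x = 1`.

Each curve is parametrized by `P = 1 + C exp t`, which makes it regular and embedded
(`isCurveParam_of_mul_eq`). The pole of `S` at `P = 1` gives the end `x → 0`; the growth `S ~ (K /
L) P` gives the end `x → L / K = x_*`.

For the separation statement, the coordinates `(P, v)` with `v = |w|` turn the sign of `symH` into a
comparison of `v + P / v` with `±S(P)`. The sets where `symH` is positive or negative then have
intervals as vertical slices, and a continuous section makes them connected
(`isPreconnected_of_section`, `separatesInTwo_of_sign`). -/

/-- The symmetric polynomial `K (x w)² + M + L (x + w) (1 - x w)`: up to the factor `ν`, this is `H`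
in the variables `x` and `w = ν y`. -/
def symH (K L M x w : ℝ) : ℝ := K * (x * w) ^ 2 + M + L * (x + w) * (1 - x * w)

/-- The inequalities between the coefficients of `symH` that determine the shape of its zero set. -/
structure CoeffBounds (K L M a ν : ℝ) : Prop where
  L_pos : 0 < L
  nu_pos : 0 < ν
  nu_lt_a : ν < a
  a_lt_one : a < 1
  K_add_L : 0 < K + L
  K_add_M : 0 < K + M
  M_pos : 0 < M
  -- The last four bounds are positivity of `symH` on pieces of boundary: at the points `(-1, ±ν)`,
  -- on the whole line `w = -a` (with `x = -P / a`), and on the halves `-1 ≤ x ≤ 0` of the lines `w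
  -- = -ν` and `w = ν`.
  edge : 0 < (K + L) * ν ^ 2 + M - L
  horizon : ∀ P, L * (a ^ 2 + P) * (1 - P) < a * (K * P ^ 2 + M)
  lower : ∀ s, 0 ≤ s → s ≤ 1 → 0 < symH K L M (-s) (-ν)
  upper : ∀ s, 0 ≤ s → s ≤ 1 → 0 < symH K L M (-s) ν

theorem nu_mul_H (ν l x y : ℝ) : ν * H ν l x y =
    symH (1 - l ^ 2 - ν ^ 2) (2 * l * ν) (ν * (1 + l ^ 2 - ν ^ 2)) x (ν * y) := by
  unfold H symH; ring

/-- The numbers `a` and `b` are the roots of `t² - l t + ν`, real because `2 √ν ≤ l` and below `1`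
because `l < 1 + ν`. -/
theorem exists_roots {ν l : ℝ} (h : Admissible ν l) :
    ∃ a b : ℝ, 0 < b ∧ b ≤ a ∧ a < 1 ∧ ν = a * b ∧ l = a + b ∧ ν * yc ν l = -a := by
  obtain ⟨h0, h1, h2, h3⟩ := h
  have hs : 0 < √ν := Real.sqrt_pos.2 h0
  have hss : √ν ^ 2 = ν := Real.sq_sqrt h0.le
  have hd : 0 ≤ l ^ 2 - 4 * ν := by nlinarith
  have hr : √(l ^ 2 - 4 * ν) ^ 2 = l ^ 2 - 4 * ν := Real.sq_sqrt hd
  have hr0 := Real.sqrt_nonneg (l ^ 2 - 4 * ν)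
  have hl : 0 < l := by linarith
  have hlt : √(l ^ 2 - 4 * ν) < l := Real.sqrt_lt' hl |>.2 (by linarith)
  have hlt2 : √(l ^ 2 - 4 * ν) < 2 - l := by
    have hl2 : l < 2 := by linarith
    exact Real.sqrt_lt' (by linarith) |>.2 (by nlinarith)
  refine ⟨(l + √(l ^ 2 - 4 * ν)) / 2, (l - √(l ^ 2 - 4 * ν)) / 2, by linarith, by linarith,
    by linarith, by linarith, by ring, ?_⟩
  unfold yc
  field_simp

theorem coeffBounds_of_roots {a b ν l : ℝ} (hb : 0 < b) (hba : b ≤ a) (ha : a < 1)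
    (hν : ν = a * b) (hl : l = a + b) :
    CoeffBounds (1 - l ^ 2 - ν ^ 2) (2 * l * ν) (ν * (1 + l ^ 2 - ν ^ 2)) a ν := by
  have ha0 : 0 < a := hb.trans_le hba
  have hb1 : b < 1 := hba.trans_lt ha
  have hν0 : 0 < ν := hν ▸ mul_pos ha0 hb
  have hνa : ν < a := by nlinarith
  have hν1 : ν < 1 := hνa.trans ha
  have hl0 : 0 < l := by linarith
  have hl1 : l < 1 + ν := by nlinarith
  have hνl : ν < l := by linarith
  have hν2 : 0 < 1 - ν ^ 2 := by nlinarith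
  have hedge : 0 < (1 - ν) * (1 + ν - l) ^ 2 :=
    mul_pos (by linarith) (pow_pos (by linarith) 2)
  refine ⟨by positivity, hν0, hνa, ha, ?_, ?_, ?_, ?_, ?_, ?_, ?_⟩
  · have : 0 < (1 - (l - ν)) * (1 + (l - ν)) := mul_pos (by linarith) (by linarith)
    linarith
  · have : 0 < (1 - ν) * ((1 + ν - l) * (1 + ν + l)) :=
      mul_pos (by linarith) (mul_pos (by linarith) (by linarith))
    linarith
  · have : 0 < 1 + l ^ 2 - ν ^ 2 := by nlinarith
    positivity
  · have := mul_pos hν0 hedge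
    linarith
  · intro P
    -- The difference of the two sides is `a (1 - a²)` times the quadratic in `P` of `h2`;
    -- completing its square leaves exactly this quantity.
    have h1 : 0 < (1 - a * b) * (a - b ^ 3) * b := by
      have : b ^ 3 < b := by nlinarith [mul_pos hb hb, mul_pos (mul_pos hb hb) hb]
      exact mul_pos (mul_pos (by nlinarith) (by linarith)) hb
    have h2 : 0 < (1 + b ^ 2) * ((1 + b ^ 2) * P ^ 2 - 2 * (a + b) * b * P + a * b * (1 + b ^ 2)) := by
      nlinarith [sq_nonneg ((1 + b ^ 2) * P - (a + b) * b)]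
    have h3 := pos_of_mul_pos_right h2 (by positivity)
    have h4 : 0 < a * (1 - a ^ 2) * ((1 + b ^ 2) * P ^ 2 - 2 * (a + b) * b * P + a * b * (1 + b ^ 2)) :=
      mul_pos (mul_pos ha0 (by nlinarith)) h3
    subst hν hl
    linarith
  · intro s hs0 hs1
    have hd : ν * (1 - l ^ 2 - ν ^ 2 + 2 * l) ≤ l * (1 - ν ^ 2) := by
      have h4 : 4 * ν ≤ l ^ 2 := by subst hν hl; nlinarith [sq_nonneg (a - b)]
      have h5 := mul_le_mul_of_nonneg_left h4 hν0.le
      have h6 : 2 * ν ≤ l := by nlinarith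
      -- Once `l²` is replaced by its lower bound `4 ν`, the inequality is linear in `l` with slope
      -- `1 - 2 ν - ν²`, so it suffices to check one end of `2 ν ≤ l ≤ 1 + ν`.
      rcases le_total 0 (1 - 2 * ν - ν ^ 2) with h7 | h7
      · have := mul_le_mul_of_nonneg_right h6 h7
        have := mul_pos hν0 hν2
        linarith
      · have := mul_le_mul_of_nonpos_right hl1.le h7
        have := sq_nonneg (1 - ν)
        linarith
    have hc : 0 < 1 - l ^ 2 - ν ^ 2 + 2 * l := by nlinarith
    -- This is `symH` at `(-s, -ν)` expanded in powers of `1 - s`: no coefficient is negative, and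
    -- the constant term is the corner value in `edge`.
    have hQ : 0 < ν * (ν * (1 - l ^ 2 - ν ^ 2 + 2 * l) * (1 - s) ^ 2
        + 2 * (l * (1 - ν ^ 2) - ν * (1 - l ^ 2 - ν ^ 2 + 2 * l)) * (1 - s)
        + (1 - ν) * (1 + ν - l) ^ 2) := by
      have := mul_nonneg (sub_nonneg.2 hd) (sub_nonneg.2 hs1)
      have h5 : 0 ≤ ν * (1 - l ^ 2 - ν ^ 2 + 2 * l) * (1 - s) ^ 2 := by positivity
      exact mul_pos hν0 (by linarith)
    unfold symH
    linarith
  · intro s hs0 hs1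
    have hQ : 0 < ν * ((1 - s) * (2 * l * (1 - ν ^ 2) - ν * (1 - l ^ 2 - ν ^ 2 - 2 * l) * (1 + s))
        + (1 - ν) * (1 + ν - l) ^ 2) := by
      have h6 : ν * (1 - l ^ 2 - ν ^ 2 - 2 * l) ≤ l * (1 - ν ^ 2) := by
        nlinarith [mul_pos hν0 hl0, mul_pos (mul_pos hν0 hl0) hl0]
      have h7 := mul_le_mul_of_nonneg_right h6 (by linarith : 0 ≤ 1 + s)
      have h8 : l * (1 - ν ^ 2) * (1 + s) ≤ l * (1 - ν ^ 2) * 2 :=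
        mul_le_mul_of_nonneg_left (by linarith) (by positivity)
      have h9 : 0 ≤ (1 - s) * (2 * l * (1 - ν ^ 2) - ν * (1 - l ^ 2 - ν ^ 2 - 2 * l) * (1 + s)) :=
        mul_nonneg (by linarith) (by linarith)
      exact mul_pos hν0 (by linarith)
    unfold symH
    linarith

/-! ### Location of the zeros, and the product as a coordinate. -/

/-- On the zero set of `symH`, the sum `x + w` is this function of the product `P = x w ≠ 1`. -/
noncomputable def sumOf (K L M P : ℝ) : ℝ := (K * P ^ 2 + M) / (L * (P - 1))

/-- The square root of the discriminant of `T² - (x + w) T + x w` on the zero set of `symH`. -/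
noncomputable def diffOf (K L M P : ℝ) : ℝ := √(sumOf K L M P ^ 2 - 4 * P)

section Location

variable {K L M a ν x w P : ℝ}

theorem symH_eq_sumOf (hL : L ≠ 0) (hP : x * w ≠ 1) :
    symH K L M x w = L * (1 - x * w) * (x + w - sumOf K L M (x * w)) := by
  have : x * w - 1 ≠ 0 := sub_ne_zero.2 hP
  unfold symH sumOf
  field_simp
  ring

theorem symH_eq_zero_iff (hL : L ≠ 0) (hP : x * w ≠ 1) :
    symH K L M x w = 0 ↔ x + w = sumOf K L M (x * w) := by
  rw [symH_eq_sumOf hL hP, mul_eq_zero, sub_eq_zero]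
  exact or_iff_right (mul_ne_zero hL (sub_ne_zero.2 hP.symm))

theorem symH_neg_one (K L M w : ℝ) : symH K L M (-1) w = (K + L) * w ^ 2 + M - L := by
  unfold symH; ring

theorem symH_one (K L M w : ℝ) : symH K L M 1 w = (K - L) * w ^ 2 + M + L := by
  unfold symH; ring

namespace CoeffBounds

theorem edge_pos (h : CoeffBounds K L M a ν) {v : ℝ} (hv : ν ≤ v) :
    0 < (K + L) * v ^ 2 + M - L := by
  have h1 : ν ^ 2 ≤ v ^ 2 := pow_le_pow_left₀ h.nu_pos.le hv 2
  have := mul_le_mul_of_nonneg_left h1 h.K_add_L.le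
  linarith [h.edge]

/-- From `(1 + x) (-1 - w) ≥ 0` one gets `x + w ≤ -(1 + P)`, so for `P ≥ 1` the value is at least
the one at `(-1, -P)`, the point of `x = -1` with the same product; that value is at least `K + M`.
-/
theorem symH_pos_of_one_le (h : CoeffBounds K L M a ν) (hx : -1 ≤ x) (hw : w < 0)
    (hP : 1 ≤ x * w) : 0 < symH K L M x w := by
  have hw1 : w ≤ -1 := by nlinarith
  have h1 : 0 ≤ (1 + x) * (-1 - w) := mul_nonneg (by linarith) (by linarith)
  have h2 : 0 ≤ L * ((1 + x) * (-1 - w)) * (x * w - 1) :=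
    mul_nonneg (mul_nonneg h.L_pos.le h1) (by linarith)
  have h3 := mul_le_mul_of_nonneg_left (by nlinarith : 1 ≤ (x * w) ^ 2) h.K_add_L.le
  have := h.K_add_M
  unfold symH
  nlinarith

/-- The product is `T² - (x + w) T + x w` at `T = -a`; `horizon` makes it negative, so `-a` lies
strictly between `x` and `w`. -/
theorem mul_add_neg_of_symH_eq_zero (h : CoeffBounds K L M a ν) (hP : x * w < 1)
    (h0 : symH K L M x w = 0) : (x + a) * (w + a) < 0 := by
  have h1 := h.horizon (x * w)
  unfold symH at h0
  have h2 : L * (1 - x * w) * ((x + a) * (w + a)) < 0 := by linear_combination h1 + a * h0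
  exact (pos_iff_neg_of_mul_neg h2).1 (mul_pos h.L_pos (by linarith))

theorem lt_of_symH_eq_zero_lower (h : CoeffBounds K L M a ν) (hx : x ∈ Icc (-1 : ℝ) 1)
    (hw : w ≤ -ν) (h0 : symH K L M x w = 0) : x * w < 1 ∧ w < -a ∧ -a < x := by
  have hν := h.nu_pos
  have hL := h.L_pos
  have hP : x * w < 1 := by
    by_contra hP
    exact (h.symH_pos_of_one_le hx.1 (by linarith) (not_lt.1 hP)).ne' h0
  have h1 := h.mul_add_neg_of_symH_eq_zero hP h0
  refine ⟨hP, ?_⟩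
  rcases mul_neg_iff.1 h1 with ⟨h2, h3⟩ | ⟨h2, h3⟩
  · exact ⟨by linarith, by linarith⟩
  exfalso
  -- The other ordering `x < -a < w ≤ -ν` is excluded by comparison with a boundary point of equal
  -- product, where `symH` is positive: on `x = -1` if `P ≥ ν`, on `w = -ν` if `P ≤ ν`.
  have hνa := h.nu_lt_a
  have ha1 := h.a_lt_one
  have hLP : 0 < L * (1 - x * w) := mul_pos hL (by linarith)
  rcases le_total ν (x * w) with h4 | h4
  · have h5 := h.edge_pos h4
    have h6 : 0 ≤ (1 + x) * (1 + w) := mul_nonneg (by linarith [hx.1]) (by linarith)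
    have h7 := mul_nonneg hLP.le h6
    unfold symH at h0
    linarith
  · have h5 := h.lower (x * w / ν) (div_nonneg (by nlinarith) hν.le) ((div_le_one hν).2 h4)
    have h7 : 0 ≤ x + w + x * w / ν + ν := by
      have : x + w + x * w / ν + ν = (x + ν) * (w + ν) / ν := by field_simp; ring
      rw [this]
      exact div_nonneg (mul_nonneg_of_nonpos_of_nonpos (by linarith) (by linarith)) hν.le
    have h8 : symH K L M (-(x * w / ν)) (-ν) =
        K * (x * w) ^ 2 + M - L * (x * w / ν + ν) * (1 - x * w) := by
      have : -(x * w / ν) * -ν = x * w := by field_simp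
      unfold symH; rw [this]; ring
    have h9 := mul_nonneg hLP.le h7
    unfold symH at h0
    linarith

theorem symH_pos_upper_of_nonpos (h : CoeffBounds K L M a ν) (hx : x ∈ Icc (-1 : ℝ) 0)
    (hw : ν ≤ w) : 0 < symH K L M x w := by
  have h1 := h.upper (-x) (by linarith [hx.2]) (by linarith [hx.1])
  have hν := h.nu_pos
  -- The right side is the increment of `symH` from `(x, ν)` to `(x, w)`.
  have h2 : 0 ≤ (w - ν) * ((K + L) * x ^ 2 * (w + ν) + L * (1 - x ^ 2) +
      L * ((w + ν) * (-x * (1 + x)))) := by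
    have h3 : 0 ≤ 1 - x ^ 2 := by nlinarith [hx.1, hx.2]
    have h4 : 0 ≤ -x * (1 + x) := mul_nonneg (by linarith [hx.2]) (by linarith [hx.1])
    have h5 : 0 ≤ w + ν := by linarith
    have := h.L_pos.le
    have := h.K_add_L.le
    exact mul_nonneg (by linarith) (by positivity)
  unfold symH at h1 ⊢
  linarith

theorem symH_pos_upper (h : CoeffBounds K L M a ν) (hx : x ∈ Icc (-1 : ℝ) 1)
    (hw : ν ≤ w) (hP : x * w ≤ 1) : 0 < symH K L M x w := by
  rcases le_total x 0 with hx0 | hx0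
  · exact h.symH_pos_upper_of_nonpos ⟨hx.1, hx0⟩ hw
  have hν := h.nu_pos
  have hxw : 0 ≤ x * w := mul_nonneg hx0 (by linarith)
  have h1 : (x * w) ^ 2 ≤ 1 := by nlinarith
  have h2 : 0 < K * (x * w) ^ 2 + M := by
    rcases le_total 0 K with hK | hK
    · have := mul_nonneg hK (sq_nonneg (x * w)); linarith [h.M_pos]
    · have := mul_le_mul_of_nonpos_left h1 hK; linarith [h.K_add_M]
  have h3 : 0 ≤ L * (x + w) * (1 - x * w) :=
    mul_nonneg (mul_nonneg h.L_pos.le (by linarith)) (by linarith)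
  unfold symH
  linarith

theorem horizon_sumOf (h : CoeffBounds K L M a ν) (hP : P < 1) :
    a ^ 2 + a * sumOf K L M P + P < 0 := by
  have h1 := h.horizon P
  have hL := h.L_pos
  have h2 : sumOf K L M P * (L * (1 - P)) = -(K * P ^ 2 + M) := by
    have : P - 1 ≠ 0 := by linarith
    unfold sumOf; field_simp; ring
  have h3 : L * (1 - P) * (a ^ 2 + a * sumOf K L M P + P) < 0 := by
    linear_combination h1 + a * h2
  exact (pos_iff_neg_of_mul_neg h3).1 (mul_pos hL (by linarith))

theorem disc_pos_lower (h : CoeffBounds K L M a ν) (hP : P < 1) :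
    0 < sumOf K L M P ^ 2 - 4 * P := by
  nlinarith [h.horizon_sumOf hP, sq_nonneg (2 * a + sumOf K L M P)]

theorem abs_lt_diffOf (h : CoeffBounds K L M a ν) (hP : P < 1) :
    |2 * a + sumOf K L M P| < diffOf K L M P := by
  refine Real.lt_sqrt_of_sq_lt ?_
  rw [sq_abs]
  nlinarith [h.horizon_sumOf hP]

theorem one_add_le_sumOf (hL : 0 < L) (hP : 1 < P) (hc : 0 ≤ (K - L) * P ^ 2 + M + L) :
    1 + P ≤ sumOf K L M P := by
  unfold sumOf
  rw [le_div_iff₀ (mul_pos hL (by linarith))]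
  linarith

theorem disc_ge_upper (hL : 0 < L) (hP : 1 < P) (hc : 0 ≤ (K - L) * P ^ 2 + M + L) :
    (P - 1) ^ 2 ≤ sumOf K L M P ^ 2 - 4 * P := by
  have := one_add_le_sumOf hL hP hc
  nlinarith

theorem le_diffOf_upper (hL : 0 < L) (hP : 1 < P) (hc : 0 ≤ (K - L) * P ^ 2 + M + L) :
    P - 1 ≤ diffOf K L M P :=
  Real.le_sqrt_of_sq_le (disc_ge_upper hL hP hc)

end CoeffBounds

theorem half_sum_mul_half_diff (hd : 0 ≤ sumOf K L M P ^ 2 - 4 * P) :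
    (sumOf K L M P + diffOf K L M P) / 2 * ((sumOf K L M P - diffOf K L M P) / 2) = P := by
  have : diffOf K L M P ^ 2 = _ := Real.sq_sqrt hd
  linear_combination -this / 4

/-- The zeros of `symH` in the lower region, in terms of the product `P = x w`. -/
theorem lower_zero_iff (h : CoeffBounds K L M a ν) :
    (x ∈ Icc (-1 : ℝ) 1 ∧ w < -a ∧ symH K L M x w = 0) ↔
      ∃ P < 1, 0 ≤ (K - L) * P ^ 2 + M + L ∧
        x = (sumOf K L M P + diffOf K L M P) / 2 ∧ w = (sumOf K L M P - diffOf K L M P) / 2 := by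
  have hν := h.nu_pos
  have hνa := h.nu_lt_a
  have ha1 := h.a_lt_one
  constructor
  · rintro ⟨hx, hw, h0⟩
    obtain ⟨hP, -, hxa⟩ := h.lt_of_symH_eq_zero_lower hx (by linarith) h0
    have hS := (symH_eq_zero_iff h.L_pos.ne' hP.ne).1 h0
    have hd : diffOf K L M (x * w) = x - w := by
      unfold diffOf
      rw [← hS, show (x + w) ^ 2 - 4 * (x * w) = (x - w) ^ 2 by ring]
      exact Real.sqrt_sq (by linarith)
    refine ⟨x * w, hP, ?_, by rw [hd, ← hS]; ring, by rw [hd, ← hS]; ring⟩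
    -- On the zero set `(K - L) P² + M + L = L (1 - P) (1 - x) (1 - w)`. Since `P < 1` and `w < 0`,
    -- its sign is that of `1 - x`.
    have h1 : 0 ≤ L * (1 - x * w) * ((1 - x) * (1 - w)) :=
      mul_nonneg (mul_nonneg h.L_pos.le (by linarith))
        (mul_nonneg (by linarith [hx.2]) (by linarith))
    unfold symH at h0
    linarith
  · rintro ⟨P, hP, hc, rfl, rfl⟩
    have h1 := abs_lt.1 (h.abs_lt_diffOf hP)
    have hprod := half_sum_mul_half_diff (h.disc_pos_lower hP).le
    set x := (sumOf K L M P + diffOf K L M P) / 2 with hx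
    set w := (sumOf K L M P - diffOf K L M P) / 2 with hw
    have hS : x + w = sumOf K L M P := by rw [hx, hw]; ring
    have hxa : -a < x := by linarith
    have hwa : w < -a := by linarith
    have h0 : symH K L M x w = 0 := by
      rw [symH_eq_zero_iff h.L_pos.ne' (by rw [hprod]; exact hP.ne), hprod, hS]
    refine ⟨⟨by linarith, ?_⟩, hwa, h0⟩
    have h2 : 0 ≤ L * (1 - P) * ((1 - x) * (1 - w)) := by
      have : L * (1 - P) * ((1 - x) * (1 - w)) = (K - L) * P ^ 2 + M + L - symH K L M x w := by
        unfold symH; rw [← hprod]; ring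
      rw [this, h0, sub_zero]; exact hc
    have h3 := nonneg_of_mul_nonneg_right h2 (mul_pos h.L_pos (by linarith))
    linarith [nonneg_of_mul_nonneg_left h3 (by linarith)]

/-- The zeros of `symH` in the upper region, in terms of the product `P = x w`. -/
theorem upper_zero_iff (h : CoeffBounds K L M a ν) :
    (x ∈ Icc (-1 : ℝ) 1 ∧ ν < w ∧ symH K L M x w = 0) ↔
      ∃ P > 1, 0 ≤ (K - L) * P ^ 2 + M + L ∧
        x = (sumOf K L M P - diffOf K L M P) / 2 ∧ w = (sumOf K L M P + diffOf K L M P) / 2 := by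
  have hν := h.nu_pos
  have hL := h.L_pos
  have hν1 := h.nu_lt_a.trans h.a_lt_one
  constructor
  · rintro ⟨hx, hw, h0⟩
    have hP : 1 < x * w := by
      by_contra hP
      exact (h.symH_pos_upper hx hw.le (not_lt.1 hP)).ne' h0
    have hw1 : 1 < w := by nlinarith [hx.1, hx.2]
    have hS := (symH_eq_zero_iff hL.ne' hP.ne').1 h0
    have hd : diffOf K L M (x * w) = w - x := by
      unfold diffOf
      rw [← hS, show (x + w) ^ 2 - 4 * (x * w) = (w - x) ^ 2 by ring]
      exact Real.sqrt_sq (by linarith [hx.2])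
    refine ⟨x * w, hP, ?_, by rw [hd, ← hS]; ring, by rw [hd, ← hS]; ring⟩
    have h1 : 0 ≤ L * (x * w - 1) * ((1 - x) * (w - 1)) :=
      mul_nonneg (mul_nonneg hL.le (by linarith))
        (mul_nonneg (by linarith [hx.2]) (by linarith))
    unfold symH at h0
    linarith
  · rintro ⟨P, hP, hc, rfl, rfl⟩
    have h1 := CoeffBounds.le_diffOf_upper hL hP hc
    have h2 := CoeffBounds.one_add_le_sumOf hL hP hc
    have hprod := half_sum_mul_half_diff
      ((sq_nonneg _).trans (CoeffBounds.disc_ge_upper hL hP hc))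
    rw [mul_comm] at hprod
    set x := (sumOf K L M P - diffOf K L M P) / 2 with hx
    set w := (sumOf K L M P + diffOf K L M P) / 2 with hw
    have hS : x + w = sumOf K L M P := by rw [hx, hw]; ring
    have hw1 : P ≤ w := by linarith
    have h0 : symH K L M x w = 0 := by
      rw [symH_eq_zero_iff h.L_pos.ne' (by rw [hprod]; exact hP.ne'), hprod, hS]
    have hx0 : 0 < x := pos_of_mul_pos_left (by rw [hprod]; linarith) (by linarith : 0 ≤ w)
    have h3 : 0 ≤ (1 - x) * (w - 1) := by
      have : (1 - x) * (w - 1) = x + w - 1 - x * w := by ring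
      rw [this, hS, hprod]; linarith
    have h4 := nonneg_of_mul_nonneg_left h3 (by linarith)
    exact ⟨⟨by linarith, by linarith⟩, by linarith, h0⟩

end Location

/-! ### Regularity and asymptotics of curves with `P = 1 + C exp t`. -/

theorem isEmbedding_const_add_mul_exp {C : ℝ} (hC : C ≠ 0) :
    IsEmbedding fun t : ℝ => 1 + C * Real.exp t := by
  have h1 : IsEmbedding Real.exp := by
    have : Real.exp = Subtype.val ∘ Real.expOrderIso := by ext; simp
    rw [this]
    exact IsEmbedding.subtypeVal.comp Real.expOrderIso.toHomeomorph.isEmbedding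
  exact ((Homeomorph.mulLeft₀ C hC).trans (Homeomorph.addLeft 1)).isEmbedding.comp h1

/-- A smooth curve along which `x (ν y) = 1 + C exp t` is regular and embedded. -/
theorem isCurveParam_of_mul_eq {I : Set ℝ} {c : ℝ → ℝ × ℝ} {γ : Set (ℝ × ℝ)} {ν C : ℝ}
    (hI : UniqueDiffOn ℝ I) (hC : C ≠ 0) (hc : ContDiffOn ℝ ∞ c I)
    (hP : ∀ t ∈ I, (c t).1 * (ν * (c t).2) = 1 + C * Real.exp t) (him : c '' I = γ) :
    IsCurveParam I c γ where
  contDiffOn := hc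
  image_eq := him
  regular t ht h0 := by
    have h1 : HasDerivWithinAt c (derivWithin c I t) I t :=
      ((hc.differentiableOn (by simp)) t ht).hasDerivWithinAt
    rw [h0] at h1
    have h2 : HasDerivWithinAt (fun s => (c s).1) 0 I t := h1.fst
    have h3 : HasDerivWithinAt (fun s => (c s).2) 0 I t := h1.snd
    have h4 := h2.mul (h3.const_mul ν)
    have h5 : HasDerivWithinAt (fun s => 1 + C * Real.exp s) (C * Real.exp t) I t :=
      (((Real.hasDerivAt_exp t).const_mul C).const_add 1).hasDerivWithinAt
    have h6 := h5.congr (fun s hs => hP s hs) (hP t ht)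
    have h7 := (hI t ht).eq_deriv _ h6 h4
    simp [hC, Real.exp_ne_zero] at h7
  isEmbedding := by
    have h1 : Continuous fun t : I => c t := hc.continuousOn.domRestrict
    have h2 : Continuous fun p : ℝ × ℝ => p.1 * (ν * p.2) := by fun_prop
    -- The product `x w` already embeds the parameter interval in the line, which forces `c` to be
    -- an embedding.
    refine IsEmbedding.of_comp h1 h2 ?_
    have : ((fun p : ℝ × ℝ => p.1 * (ν * p.2)) ∘ fun t : I => c t) =
        (fun t : ℝ => 1 + C * Real.exp t) ∘ ((↑) : I → ℝ) := by
      ext t; exact hP t t.2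
    rw [this]
    exact (isEmbedding_const_add_mul_exp hC).comp .subtypeVal

/-- If `x` is bounded and both `x + w` and `x w` grow like `g → ∞`, then `w` grows like `g` and `x`
converges. -/
theorem tendsto_of_sum_of_prod {F : Filter ℝ} {x w g : ℝ → ℝ} {σ π : ℝ} (hσ : σ ≠ 0)
    (hg : Tendsto g F atTop) (hx : ∀ᶠ t in F, |x t| ≤ 1)
    (hS : Tendsto (fun t => (x t + w t) / g t) F (𝓝 σ))
    (hP : Tendsto (fun t => x t * w t / g t) F (𝓝 π)) :
    Tendsto x F (𝓝 (π / σ)) ∧ Tendsto (fun t => w t / g t) F (𝓝 σ) := by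
  have h1 : Tendsto (fun t => x t / g t) F (𝓝 0) := by
    refine squeeze_zero_norm' ?_ (tendsto_inv_atTop_zero.comp hg)
    filter_upwards [hx, hg.eventually_gt_atTop 0] with t h1 h2
    rw [norm_div, Real.norm_eq_abs, Real.norm_eq_abs, abs_of_pos h2, div_eq_mul_inv]
    exact mul_le_of_le_one_left (inv_nonneg.2 h2.le) h1
  have h2 : Tendsto (fun t => w t / g t) F (𝓝 σ) := by
    have := hS.sub h1
    rw [sub_zero] at this
    refine this.congr fun t => ?_
    ring
  refine ⟨?_, h2⟩
  refine (hP.div h2 hσ).congr' ?_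
  filter_upwards [hg.eventually_gt_atTop 0, h2.eventually_ne hσ] with t h3 h4
  have : w t ≠ 0 := by rintro h; simp [h] at h4
  simp only [Pi.div_apply]
  field_simp

section Limits

variable {K L M C : ℝ}

/-- Here `P → 1`, where `S` has a simple pole with residue `(K + M) / L`, while the product stays
bounded; hence `x → 0`. -/
theorem tendsto_sumOf_atBot (hL : L ≠ 0) (hC : C ≠ 0) :
    Tendsto (fun t => sumOf K L M (1 + C * Real.exp t) / Real.exp (-t)) atBot
      (𝓝 ((K + M) / (L * C))) := by
  have h1 : Tendsto (fun t => (K * (1 + C * Real.exp t) ^ 2 + M) / (L * C)) atBot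
      (𝓝 ((K * (1 + C * 0) ^ 2 + M) / (L * C))) :=
    ((((Real.tendsto_exp_atBot.const_mul C).const_add 1).pow 2).const_mul K).add_const M
      |>.div_const _
  simp only [mul_zero, add_zero, one_pow, mul_one] at h1
  refine h1.congr fun t => ?_
  have := Real.exp_ne_zero t
  rw [sumOf, Real.exp_neg]
  field_simp
  ring

theorem tendsto_prod_atBot (C : ℝ) :
    Tendsto (fun t => (1 + C * Real.exp t) / Real.exp (-t)) atBot (𝓝 0) := by
  have h1 := ((Real.tendsto_exp_atBot.const_mul C).const_add 1).mul Real.tendsto_exp_atBot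
  rw [mul_zero] at h1
  refine h1.congr fun t => ?_
  rw [Real.exp_neg, div_inv_eq_mul]

/-- Here `|P| → ∞` and `S ~ (K / L) P`; the ratio of product to sum then gives the limit `L / K` of
`x`. -/
theorem tendsto_sumOf_atTop (hL : L ≠ 0) (hC : C ≠ 0) :
    Tendsto (fun t => sumOf K L M (1 + C * Real.exp t) / Real.exp t) atTop
      (𝓝 (K * C / L)) := by
  have h0 : Tendsto (fun t : ℝ => Real.exp (-t)) atTop (𝓝 0) :=
    Real.tendsto_exp_neg_atTop_nhds_zero
  have h1 := (((h0.add_const C).pow 2).const_mul K).add ((h0.pow 2).const_mul M)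
    |>.div_const (L * C)
  have h2 : (K * (0 + C) ^ 2 + M * 0 ^ 2) / (L * C) = K * C / L := by field_simp; ring
  rw [h2] at h1
  refine h1.congr fun t => ?_
  have := Real.exp_ne_zero t
  rw [sumOf, Real.exp_neg]
  field_simp
  ring

theorem tendsto_prod_atTop (C : ℝ) :
    Tendsto (fun t => (1 + C * Real.exp t) / Real.exp t) atTop (𝓝 C) := by
  have h1 := Real.tendsto_exp_neg_atTop_nhds_zero.add_const C
  rw [zero_add] at h1
  refine h1.congr fun t => ?_
  have := Real.exp_ne_zero t
  rw [Real.exp_neg]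
  field_simp

end Limits

/-- The asymptotics of a curve in the zero set of `symH` along which `x w = 1 + C exp t`,
where `w = ν y`. -/
theorem tendsto_curve_atBot {K L M C ν : ℝ} {c : ℝ → ℝ × ℝ} (hL : 0 < L) (hKM : 0 < K + M)
    (hν : 0 < ν) (hC : C ≠ 0)
    (hx : ∀ᶠ t in atBot, |(c t).1| ≤ 1)
    (hS : ∀ᶠ t in atBot, (c t).1 + ν * (c t).2 = sumOf K L M (1 + C * Real.exp t))
    (hP : ∀ᶠ t in atBot, (c t).1 * (ν * (c t).2) = 1 + C * Real.exp t) :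
    (0 < C → Tendsto c atBot (𝓝 0 ×ˢ atTop)) ∧ (C < 0 → Tendsto c atBot (𝓝 0 ×ˢ atBot)) := by
  have hg : Tendsto (fun t : ℝ => Real.exp (-t)) atBot atTop :=
    Real.tendsto_exp_atTop.comp tendsto_neg_atBot_atTop
  obtain ⟨h1, h2⟩ := tendsto_of_sum_of_prod (x := fun t => (c t).1) (w := fun t => ν * (c t).2)
    (div_ne_zero hKM.ne' (mul_ne_zero hL.ne' hC)) hg hx
    ((tendsto_sumOf_atBot hL.ne' hC).congr' (hS.mono fun t h => by simp only [h]))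
    ((tendsto_prod_atBot C).congr' (hP.mono fun t h => by simp only [h]))
  rw [zero_div] at h1
  have e : ∀ t, ν * (c t).2 / Real.exp (-t) * (Real.exp (-t) / ν) = (c t).2 := fun t => by
    have := Real.exp_ne_zero (-t)
    field_simp
  have hg' := hg.atTop_div_const hν
  exact ⟨fun h => h1.prodMk ((h2.pos_mul_atTop (div_pos hKM (mul_pos hL h)) hg').congr e),
    fun h => h1.prodMk
      ((h2.neg_mul_atTop (div_neg_of_pos_of_neg hKM (mul_neg_of_pos_of_neg hL h)) hg').congr e)⟩

theorem tendsto_curve_atTop {K L M C ν : ℝ} {c : ℝ → ℝ × ℝ} (hL : 0 < L) (hK : 0 < K)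
    (hν : 0 < ν) (hC : C ≠ 0)
    (hx : ∀ᶠ t in atTop, |(c t).1| ≤ 1)
    (hS : ∀ᶠ t in atTop, (c t).1 + ν * (c t).2 = sumOf K L M (1 + C * Real.exp t))
    (hP : ∀ᶠ t in atTop, (c t).1 * (ν * (c t).2) = 1 + C * Real.exp t) :
    (0 < C → Tendsto c atTop (𝓝 (L / K) ×ˢ atTop)) ∧
      (C < 0 → Tendsto c atTop (𝓝 (L / K) ×ˢ atBot)) := by
  obtain ⟨h1, h2⟩ := tendsto_of_sum_of_prod (x := fun t => (c t).1) (w := fun t => ν * (c t).2)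
    (div_ne_zero (mul_ne_zero hK.ne' hC) hL.ne') Real.tendsto_exp_atTop hx
    ((tendsto_sumOf_atTop (M := M) hL.ne' hC).congr' (hS.mono fun t h => by simp only [h]))
    ((tendsto_prod_atTop C).congr' (hP.mono fun t h => by simp only [h]))
  have h3 : C / (K * C / L) = L / K := by field_simp
  rw [h3] at h1
  have e : ∀ t, ν * (c t).2 / Real.exp t * (Real.exp t / ν) = (c t).2 := fun t => by
    have := Real.exp_ne_zero t
    field_simp
  have hg' := Real.tendsto_exp_atTop.atTop_div_const hν
  exact ⟨fun h => h1.prodMk ((h2.pos_mul_atTop (div_pos (mul_pos hK h) hL) hg').congr e),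
    fun h => h1.prodMk
      ((h2.neg_mul_atTop (div_neg_of_neg_of_pos (mul_neg_of_pos_of_neg hK h) hL) hg').congr e)⟩

/-- `sumOf` is smooth away from `P = 1`. -/
theorem contDiffAt_sumOf {K L M P : ℝ} (hL : L ≠ 0) (hP : P ≠ 1) :
    ContDiffAt ℝ ∞ (sumOf K L M) P := by
  unfold sumOf
  exact ContDiffAt.div (by fun_prop) (by fun_prop) (mul_ne_zero hL (sub_ne_zero.2 hP))

theorem contDiffAt_diffOf {K L M P : ℝ} (hL : L ≠ 0) (hP : P ≠ 1)
    (hd : 0 < sumOf K L M P ^ 2 - 4 * P) : ContDiffAt ℝ ∞ (diffOf K L M) P := by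
  have := contDiffAt_sumOf (K := K) (M := M) hL hP
  unfold diffOf
  exact ContDiffAt.sqrt (by fun_prop) hd.ne'

/-! ### Criteria for connectedness and separation. -/

/-- A planar set whose vertical slices are intervals is connected if it contains the graph of a
continuous function over an interval onto which it projects. -/
theorem isPreconnected_of_section {U : Set (ℝ × ℝ)} {J : Set ℝ} {σ : ℝ → ℝ}
    (hJ : J.OrdConnected) (hσ : ContinuousOn σ J) (hsec : ∀ P ∈ J, (P, σ P) ∈ U)
    (hU : ∀ p ∈ U, p.1 ∈ J) (hfib : ∀ P, {v | (P, v) ∈ U}.OrdConnected) :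
    IsPreconnected U := by
  have hT : IsPreconnected ((fun P => (P, σ P)) '' J) :=
    hJ.isPreconnected.image _ (continuousOn_id.prodMk hσ)
  have hV : ∀ p : ℝ × ℝ, IsPreconnected (Prod.mk p.1 '' uIcc p.2 (σ p.1)) := fun p =>
    isPreconnected_uIcc.image _ (by fun_prop)
  have hVU : ∀ p ∈ U, Prod.mk p.1 '' uIcc p.2 (σ p.1) ⊆ U := by
    rintro p hp _ ⟨v, hv, rfl⟩
    exact (hfib p.1).uIcc_subset (show (p.1, p.2) ∈ U from hp) (hsec _ (hU p hp)) hv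
  have hTU : (fun P => (P, σ P)) '' J ⊆ U := by
    rintro _ ⟨P, hP, rfl⟩
    exact hsec P hP
  have hmem : ∀ p ∈ U, (p.1, σ p.1) ∈ (fun P => (P, σ P)) '' J := fun p hp =>
    ⟨p.1, hU p hp, rfl⟩
  refine isPreconnected_of_forall_pair fun p hp q hq => ?_
  refine ⟨Prod.mk p.1 '' uIcc p.2 (σ p.1) ∪ (fun P => (P, σ P)) '' J ∪
      Prod.mk q.1 '' uIcc q.2 (σ q.1), ?_, ?_, ?_, ?_⟩
  · exact union_subset (union_subset (hVU p hp) hTU) (hVU q hq)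
  · exact Or.inl (Or.inl ⟨p.2, left_mem_uIcc, rfl⟩)
  · exact Or.inr ⟨q.2, left_mem_uIcc, rfl⟩
  · refine IsPreconnected.union (q.1, σ q.1) (Or.inr (hmem q hq)) ⟨_, right_mem_uIcc, rfl⟩ ?_ (hV q)
    exact IsPreconnected.union (p.1, σ p.1) ⟨_, right_mem_uIcc, rfl⟩ (hmem p hp) (hV p) hT

/-- The zero set of a continuous function separates a set in two if the function takes both signs
and the sets where it is positive and where it is negative are connected. -/
theorem separatesInTwo_of_sign {R : Set (ℝ × ℝ)} {f : ℝ × ℝ → ℝ} (hf : Continuous f)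
    (hpos : IsConnected {p ∈ R | 0 < f p}) (hneg : IsConnected {p ∈ R | f p < 0}) :
    SeparatesInTwo {p ∈ R | f p = 0} R := by
  refine ⟨fun p hp => hp.1, ?_⟩
  set X := ↥(R \ {p ∈ R | f p = 0})
  have hne : ∀ p : X, f p ≠ 0 := fun p h => p.2.2 ⟨p.2.1, h⟩
  let s : X → Bool := fun p => decide (0 < f p)
  have hfX : Continuous fun p : X => f p := hf.comp continuous_subtype_val
  have hs : Continuous s := by
    -- Because `f` does not vanish on `X`, its positivity set is both `{0 ≤ f}` and `{0 < f}`, hence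
    -- clopen.
    refine continuous_bool_rng true |>.2 ⟨?_, ?_⟩
    · have : s ⁻¹' {true} = {p : X | 0 ≤ f p} := by
        ext p
        simp only [s, mem_preimage, mem_singleton_iff, decide_eq_true_eq, mem_ofPred_eq]
        exact ⟨le_of_lt, fun h => lt_of_le_of_ne h (hne p).symm⟩
      rw [this]
      exact isClosed_le continuous_const hfX
    · have : s ⁻¹' {true} = {p : X | 0 < f p} := by
        ext p
        simp [s]
      rw [this]
      exact isOpen_lt continuous_const hfX
  have hconn : ∀ A : Set (ℝ × ℝ), IsConnected A → A ⊆ R \ {p ∈ R | f p = 0} →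
      IsPreconnected ((↑) ⁻¹' A : Set X) := by
    intro A hA hAX
    rw [← IsInducing.subtypeVal.isPreconnected_image, image_preimage_eq_inter_range,
      Subtype.range_coe, inter_eq_left.2 hAX]
    exact hA.isPreconnected
  have hposX := hconn _ hpos fun p hp => ⟨hp.1, fun h => hp.2.ne' h.2⟩
  have hnegX := hconn _ hneg fun p hp => ⟨hp.1, fun h => hp.2.ne h.2⟩
  have hbij : Function.Bijective hs.connectedComponentsLift := by
    constructor
    · intro u v
      obtain ⟨p, rfl⟩ := ConnectedComponents.surjective_coe u
      obtain ⟨q, rfl⟩ := ConnectedComponents.surjective_coe v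
      simp only [Continuous.connectedComponentsLift_apply_coe]
      intro hpq
      rw [ConnectedComponents.coe_eq_coe']
      by_cases hp : 0 < f p
      · have hq : 0 < f q := by simpa [s, hp] using hpq
        exact hposX.subset_connectedComponent (show q ∈ _ from ⟨q.2.1, hq⟩) ⟨p.2.1, hp⟩
      · have hq : ¬ 0 < f q := by simpa [s, hp] using hpq
        exact hnegX.subset_connectedComponent
          (show q ∈ _ from ⟨q.2.1, lt_of_le_of_ne (not_lt.1 hq) (hne q)⟩)
          ⟨p.2.1, lt_of_le_of_ne (not_lt.1 hp) (hne p)⟩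
    · rintro (_ | _)
      · obtain ⟨p, hp⟩ := hneg.nonempty
        refine ⟨((⟨p, hp.1, fun h => hp.2.ne h.2⟩ : X) : ConnectedComponents X), ?_⟩
        simpa [s] using hp.2.le
      · obtain ⟨p, hp⟩ := hpos.nonempty
        refine ⟨((⟨p, hp.1, fun h => hp.2.ne' h.2⟩ : X) : ConnectedComponents X), ?_⟩
        simpa [s] using hp.2
  rw [Nat.card_eq_of_bijective _ hbij]
  simp

/-! ### Connectedness of the sign regions in the coordinates `(P, v)`. -/

section Regions

variable {K L M a ν P : ℝ}

theorem symH_neg_div_neg {v : ℝ} (hL : L ≠ 0) (hP : P ≠ 1) (hv : v ≠ 0) :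
    symH K L M (-(P / v)) (-v) = L * (1 - P) * (-sumOf K L M P - (v + P / v)) := by
  have h1 : -(P / v) * -v = P := by field_simp
  rw [symH_eq_sumOf hL (by rwa [h1]), h1]
  ring

theorem symH_div {v : ℝ} (hL : L ≠ 0) (hP : P ≠ 1) (hv : v ≠ 0) :
    symH K L M (P / v) v = L * (P - 1) * (sumOf K L M P - (v + P / v)) := by
  have h1 : P / v * v = P := by field_simp
  rw [symH_eq_sumOf hL (by rwa [h1]), h1]
  ring

theorem add_div_le_add_div {u v : ℝ} (hu : 0 < u) (huv : u ≤ v) (hP : P ≤ u * v) :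
    u + P / u ≤ v + P / v := by
  have hv : 0 < v := hu.trans_le huv
  have h1 : v + P / v - (u + P / u) = (v - u) * (u * v - P) / (u * v) := by field_simp; ring
  have h2 : 0 ≤ (v - u) * (u * v - P) / (u * v) :=
    div_nonneg (mul_nonneg (by linarith) (by linarith)) (by positivity)
  linarith

/-- Once `v + P / v` exceeds its value at `a < v`, it is nondecreasing. -/
theorem add_div_le_add_div_of_lt {u v : ℝ} (ha : 0 < a) (hu : a < u) (huv : u ≤ v)
    (h : a + P / a < u + P / u) : u + P / u ≤ v + P / v := by
  have hu0 : 0 < u := ha.trans hu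
  refine add_div_le_add_div hu0 huv ?_
  have h1 : u + P / u - (a + P / a) = (u - a) * (a * u - P) / (a * u) := by field_simp; ring
  have h2 : 0 < (u - a) * (a * u - P) / (a * u) := by linarith
  have h3 := (pos_iff_pos_of_mul_pos ((div_pos_iff_of_pos_right (by positivity)).1 h2)).1
    (by linarith)
  nlinarith

theorem coeff_pos_of_sq_le {P Q : ℝ} (hML : 0 < M + L) (hPQ : P ^ 2 ≤ Q ^ 2)
    (hQ : 0 < (K - L) * Q ^ 2 + M + L) : 0 < (K - L) * P ^ 2 + M + L := by
  rcases le_total 0 (K - L) with h | h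
  · have := mul_nonneg h (sq_nonneg P); linarith
  · have := mul_le_mul_of_nonpos_left hPQ h; linarith

theorem continuousOn_sumOf {J : Set ℝ} (hL : L ≠ 0) (hJ : ∀ P ∈ J, P ≠ 1) :
    ContinuousOn (sumOf K L M) J := fun P hP =>
  (contDiffAt_sumOf hL (hJ P hP)).continuousAt.continuousWithinAt

theorem neg_one_le_div {v : ℝ} (hv : 0 < v) (hP : |P| ≤ v) : -1 ≤ P / v ∧ P / v ≤ 1 := by
  have := abs_le.1 hP
  exact ⟨by rw [le_div_iff₀ hv]; linarith, by rw [div_le_one hv]; linarith⟩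

namespace CoeffBounds

theorem a_pos (h : CoeffBounds K L M a ν) : 0 < a := h.nu_pos.trans h.nu_lt_a

theorem add_div_lt_neg_sumOf (h : CoeffBounds K L M a ν) (hP : P < 1) :
    a + P / a < -sumOf K L M P := by
  have h1 := h.horizon_sumOf hP
  have ha := h.a_pos
  have h2 : a + P / a = (a ^ 2 + P) / a := by field_simp
  rw [h2, div_lt_iff₀ ha]
  linarith

theorem symH_neg_iff_lower (h : CoeffBounds K L M a ν) {v : ℝ} (hP : P < 1) (hv : 0 < v) :
    symH K L M (-(P / v)) (-v) < 0 ↔ -sumOf K L M P < v + P / v := by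
  have hLP : 0 < L * (1 - P) := mul_pos h.L_pos (by linarith)
  rw [symH_neg_div_neg h.L_pos.ne' hP.ne hv.ne', ← neg_pos, ← mul_neg, mul_pos_iff_of_pos_left hLP, neg_pos,
    sub_neg]

theorem symH_pos_iff_lower (h : CoeffBounds K L M a ν) {v : ℝ} (hP : P < 1) (hv : 0 < v) :
    0 < symH K L M (-(P / v)) (-v) ↔ v + P / v < -sumOf K L M P := by
  have hLP : 0 < L * (1 - P) := mul_pos h.L_pos (by linarith)
  rw [symH_neg_div_neg h.L_pos.ne' hP.ne hv.ne', mul_pos_iff_of_pos_left hLP, sub_pos]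

theorem symH_pos_lower_of_one_le (h : CoeffBounds K L M a ν) {v : ℝ} (hP : 1 ≤ P) (hv : 0 < v)
    (hPv : |P| ≤ v) : 0 < symH K L M (-(P / v)) (-v) := by
  refine h.symH_pos_of_one_le (by linarith [(neg_one_le_div hv hPv).2]) (by linarith) ?_
  have : -(P / v) * -v = P := by field_simp
  rwa [this]

theorem symH_neg_iff_upper (h : CoeffBounds K L M a ν) {v : ℝ} (hP : 1 < P) (hv : 0 < v) :
    symH K L M (P / v) v < 0 ↔ sumOf K L M P < v + P / v := by
  have hLP : 0 < L * (P - 1) := mul_pos h.L_pos (by linarith)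
  rw [symH_div h.L_pos.ne' hP.ne' hv.ne', ← neg_pos, ← mul_neg, mul_pos_iff_of_pos_left hLP, neg_pos,
    sub_neg]

theorem symH_pos_iff_upper (h : CoeffBounds K L M a ν) {v : ℝ} (hP : 1 < P) (hv : 0 < v) :
    0 < symH K L M (P / v) v ↔ v + P / v < sumOf K L M P := by
  have hLP : 0 < L * (P - 1) := mul_pos h.L_pos (by linarith)
  rw [symH_div h.L_pos.ne' hP.ne' hv.ne', mul_pos_iff_of_pos_left hLP, sub_pos]

theorem symH_pos_upper_of_le_one (h : CoeffBounds K L M a ν) {v : ℝ} (hP : P ≤ 1) (hv : ν ≤ v)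
    (hPv : |P| ≤ v) : 0 < symH K L M (P / v) v := by
  have hv0 : 0 < v := h.nu_pos.trans_le hv
  refine h.symH_pos_upper (neg_one_le_div hv0 hPv) hv ?_
  rwa [div_mul_cancel₀ _ hv0.ne']

/-- Slices are closed upwards: at `v = a` the function `v + P / v` is below `-S(P)`, so once it has
passed `-S(P)` it no longer decreases. The section lies far up in each slice. -/
theorem isPreconnected_lower_neg (h : CoeffBounds K L M a ν) :
    IsPreconnected {q : ℝ × ℝ | a < q.2 ∧ |q.1| ≤ q.2 ∧ symH K L M (-(q.1 / q.2)) (-q.2) < 0} := by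
  have ha := h.a_pos
  have hP1 : ∀ P v : ℝ, a < v → |P| ≤ v → symH K L M (-(P / v)) (-v) < 0 → P < 1 := by
    intro P v h1 h2 h3
    by_contra hP
    exact h3.not_gt (h.symH_pos_lower_of_one_le (not_lt.1 hP) (ha.trans h1) h2)
  refine isPreconnected_of_section (J := Iio 1)
    (σ := fun P => |P| + |sumOf K L M P| + 2) ordConnected_Iio ?_ ?_ ?_ ?_
  · have := continuousOn_sumOf (K := K) (M := M) (J := Iio 1) h.L_pos.ne' fun P hP => ne_of_lt hP
    fun_prop
  · intro P hP
    have h1 := abs_nonneg P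
    have h2 := abs_nonneg (sumOf K L M P)
    have hv : |P| ≤ |P| + |sumOf K L M P| + 2 := by linarith
    have hv0 : 0 < |P| + |sumOf K L M P| + 2 := by linarith
    refine ⟨by linarith [h.a_lt_one], hv, ?_⟩
    rw [h.symH_neg_iff_lower hP hv0]
    linarith [(neg_one_le_div hv0 hv).1, neg_abs_le (sumOf K L M P)]
  · rintro ⟨P, v⟩ ⟨h1, h2, h3⟩
    exact hP1 P v h1 h2 h3
  · refine fun P => ⟨?_⟩
    rintro u ⟨hu1, hu2, hu3⟩ - - v ⟨huv, -⟩
    dsimp only at hu1 hu2 hu3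
    have hP := hP1 P u hu1 hu2 hu3
    have hu0 := ha.trans hu1
    refine ⟨hu1.trans_le huv, hu2.trans huv, ?_⟩
    rw [h.symH_neg_iff_lower hP (hu0.trans_le huv)]
    rw [h.symH_neg_iff_lower hP hu0] at hu3
    exact hu3.trans_le
      (add_div_le_add_div_of_lt ha hu1 huv ((h.add_div_lt_neg_sumOf hP).trans hu3))

theorem ordConnected_lower_pos (h : CoeffBounds K L M a ν) (P : ℝ) :
    {v | a < v ∧ |P| ≤ v ∧ 0 < symH K L M (-(P / v)) (-v)}.OrdConnected := by
  have ha := h.a_pos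
  constructor
  rintro u ⟨hu1, hu2, -⟩ v ⟨-, -, hv3⟩ t ⟨hut, htv⟩
  have ht := hu1.trans_le hut
  have ht0 := ha.trans ht
  refine ⟨ht, hu2.trans hut, ?_⟩
  rcases lt_or_ge P 1 with hP | hP
  · rw [h.symH_pos_iff_lower hP (ht0.trans_le htv)] at hv3
    rw [h.symH_pos_iff_lower hP ht0]
    by_contra hc
    have hc := not_lt.1 hc
    have := add_div_le_add_div_of_lt ha ht htv ((h.add_div_lt_neg_sumOf hP).trans_le hc)
    linarith
  · exact h.symH_pos_lower_of_one_le hP ht0 (hu2.trans hut)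

/-- The pole of `S` at `P = 1` suggests covering the positive region by `P > a` and `P < 1`. On this
piece the edge `x = -1`, that is `v = P`, is a section. -/
theorem isPreconnected_lower_pos_right (h : CoeffBounds K L M a ν) :
    IsPreconnected {q : ℝ × ℝ | a < q.1 ∧ a < q.2 ∧ |q.1| ≤ q.2 ∧
      0 < symH K L M (-(q.1 / q.2)) (-q.2)} := by
  have ha := h.a_pos
  refine isPreconnected_of_section (J := Ioi a) (σ := id) ordConnected_Ioi continuousOn_id ?_ ?_ ?_
  · intro P hP
    have hP' : a < P := hP
    have hP0 : 0 < P := ha.trans hP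
    refine ⟨hP, hP, (abs_of_pos hP0).le, ?_⟩
    simp only [id, div_self hP0.ne']
    rw [symH_neg_one, neg_sq]
    exact h.edge_pos (by linarith [h.nu_lt_a])
  · exact fun q hq => hq.1
  · intro P
    have := h.ordConnected_lower_pos P
    by_cases hP : a < P
    · simpa [hP] using this
    · simp [hP, ordConnected_empty]

theorem isPreconnected_lower_pos_left (h : CoeffBounds K L M a ν) :
    IsPreconnected {q : ℝ × ℝ | q.1 < 1 ∧ a < q.2 ∧ |q.1| ≤ q.2 ∧
      0 < symH K L M (-(q.1 / q.2)) (-q.2)} := by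
  have ha := h.a_pos
  have hML : 0 < M + L := add_pos h.M_pos h.L_pos
  -- For `P ≤ 0` the condition says that `symH` is positive at `x = 1`, `w = P`; for `P ≥ 0` the
  -- minimum makes it `0 < M + L`, no restriction.
  let J : Set ℝ := {P | P < 1 ∧ 0 < (K - L) * (min P 0) ^ 2 + M + L}
  -- This is the value of `v + P / v` at the bottom `v = max a |P|` of the slice. That bottom is
  -- itself excluded when `|P| ≤ a`, so the section must lie slightly above it.
  let g : ℝ → ℝ := fun P => max a |P| + P / max a |P|
  have hm : ∀ P : ℝ, 0 < max a |P| := fun P => ha.trans_le (le_max_left _ _)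
  have hg : ∀ P ∈ J, g P < -sumOf K L M P := by
    rintro P ⟨hP, hc⟩
    have hLP : 0 < L * (1 - P) := mul_pos h.L_pos (by linarith)
    have hS : -sumOf K L M P = (K * P ^ 2 + M) / (L * (1 - P)) := by
      rw [sumOf, ← div_neg]; congr 1; ring
    rcases le_total |P| a with h1 | h1
    · simpa [g, max_eq_left h1] using h.add_div_lt_neg_sumOf hP
    · simp only [g, max_eq_right h1]
      rcases le_total 0 P with h2 | h2
      · rw [abs_of_nonneg h2] at h1 ⊢
        rw [div_self (by linarith), hS, lt_div_iff₀ hLP]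
        linarith [h.edge_pos (h.nu_lt_a.le.trans h1)]
      · rw [abs_of_nonpos h2] at h1 ⊢
        rw [min_eq_left h2] at hc
        rw [div_neg, div_self (by linarith), hS, lt_div_iff₀ hLP]
        linarith
  -- Raising `v` from the bottom by `D P` raises `v + P / v` by at most `D P * (1 + 1 / a)`, which
  -- is half the gap to `-S(P)`.
  let D : ℝ → ℝ := fun P => (-sumOf K L M P - g P) / (2 * (1 + 1 / a))
  have hD : ∀ P ∈ J, 0 < D P := fun P hP =>
    div_pos (sub_pos.2 (hg P hP)) (by positivity)
  refine isPreconnected_of_section (J := J) (σ := fun P => max a |P| + D P) ?_ ?_ ?_ ?_ ?_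
  · constructor
    rintro P ⟨hP, hcP⟩ Q ⟨hQ, -⟩ T ⟨hPT, hTQ⟩
    refine ⟨hTQ.trans_lt hQ, coeff_pos_of_sq_le hML ?_ hcP⟩
    have h1 : min P 0 ≤ min T 0 := min_le_min_right 0 hPT
    have h2 : min T 0 ≤ 0 := min_le_right _ _
    nlinarith
  · have h1 := continuousOn_sumOf (K := K) (M := M) (J := J) h.L_pos.ne' fun P hP => ne_of_lt hP.1
    have h2 : ContinuousOn (fun P : ℝ => max a |P|) J := by fun_prop
    have h3 : ContinuousOn g J := h2.add (continuousOn_id.div h2 fun P _ => (hm P).ne')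
    exact h2.add ((h1.neg.sub h3).div_const _)
  · intro P hP
    have hD0 := hD P hP
    have hv0 : 0 < max a |P| + D P := by linarith [hm P]
    refine ⟨hP.1, by linarith [le_max_left a |P|], by linarith [le_max_right a |P|], ?_⟩
    rw [h.symH_pos_iff_lower hP.1 hv0]
    have h1 : max a |P| + D P + P / (max a |P| + D P) ≤ g P + D P * (1 + 1 / a) := by
      have h2 : P / (max a |P| + D P) - P / max a |P| ≤ D P * (1 / a) := by
        have h3 : P / (max a |P| + D P) - P / max a |P| =
            D P * ((-P) / max a |P| * (1 / (max a |P| + D P))) := by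
          have := hm P
          field_simp
          ring
        rw [h3]
        have h4 : (-P) / max a |P| ≤ 1 := by
          rw [div_le_one (hm P)]
          exact (neg_le_abs P).trans (le_max_right _ _)
        have h5 : 1 / (max a |P| + D P) ≤ 1 / a :=
          one_div_le_one_div_of_le ha (by linarith [le_max_left a |P|])
        have h6 : 0 < 1 / (max a |P| + D P) := by positivity
        refine mul_le_mul_of_nonneg_left ?_ hD0.le
        nlinarith
      simp only [g]
      linarith
    have h2 : D P * (1 + 1 / a) = (-sumOf K L M P - g P) / 2 := by
      simp only [D]
      field_simp
    linarith [hg P hP]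
  · rintro ⟨P, v⟩ ⟨hP, h1, h2, h3⟩
    dsimp only at hP h1 h2 h3
    refine ⟨hP, ?_⟩
    dsimp only
    rcases le_total 0 P with h0 | h0
    · rw [min_eq_right h0]; linarith
    rw [min_eq_left h0]
    have hv0 := ha.trans h1
    rw [h.symH_pos_iff_lower hP hv0] at h3
    have hLP : 0 < L * (1 - P) := mul_pos h.L_pos (by linarith)
    have hS : -sumOf K L M P = (K * P ^ 2 + M) / (L * (1 - P)) := by
      rw [sumOf, ← div_neg]; congr 1; ring
    have h4 : -P - 1 < -sumOf K L M P := by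
      linarith [(neg_one_le_div hv0 h2).1, neg_le_abs P]
    rw [hS, lt_div_iff₀ hLP] at h4
    linarith
  · intro P
    have := h.ordConnected_lower_pos P
    by_cases hP : P < 1
    · simpa [hP] using this
    · simp [hP, ordConnected_empty]

theorem isPreconnected_lower_pos (h : CoeffBounds K L M a ν) :
    IsPreconnected {q : ℝ × ℝ | a < q.2 ∧ |q.1| ≤ q.2 ∧ 0 < symH K L M (-(q.1 / q.2)) (-q.2)} := by
  have ha := h.a_pos
  have ha1 := h.a_lt_one
  have hu := IsPreconnected.union' (s := {q : ℝ × ℝ | q.1 < 1 ∧ a < q.2 ∧ |q.1| ≤ q.2 ∧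
      0 < symH K L M (-(q.1 / q.2)) (-q.2)}) ?_
    h.isPreconnected_lower_pos_left h.isPreconnected_lower_pos_right
  · convert hu using 1
    ext ⟨P, v⟩
    simp only [mem_ofPred_eq, mem_union]
    constructor
    · intro hq
      rcases lt_or_ge P 1 with hP | hP
      · exact Or.inl ⟨hP, hq⟩
      · exact Or.inr ⟨by linarith, hq⟩
    · rintro (hq | hq) <;> exact hq.2
  · have h1 : a < (a + 1) / 2 := by linarith
    have h0 : 0 < (a + 1) / 2 := by linarith
    have h2 : 0 < symH K L M (-((a + 1) / 2 / ((a + 1) / 2))) (-((a + 1) / 2)) := by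
      rw [div_self h0.ne', symH_neg_one, neg_sq]
      exact h.edge_pos (by linarith [h.nu_lt_a])
    have h3 : |(a + 1) / 2| ≤ (a + 1) / 2 := (abs_of_pos h0).le
    exact ⟨((a + 1) / 2, (a + 1) / 2), ⟨by dsimp only; linarith, h1, h3, h2⟩, ⟨h1, h1, h3, h2⟩⟩

theorem isPreconnected_upper_neg (h : CoeffBounds K L M a ν) :
    IsPreconnected {q : ℝ × ℝ | ν < q.2 ∧ |q.1| ≤ q.2 ∧ symH K L M (q.1 / q.2) q.2 < 0} := by
  have hν := h.nu_pos
  have hP1 : ∀ P v : ℝ, ν < v → |P| ≤ v → symH K L M (P / v) v < 0 → 1 < P := by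
    intro P v h1 h2 h3
    by_contra hP
    exact h3.not_gt (h.symH_pos_upper_of_le_one (not_lt.1 hP) h1.le h2)
  refine isPreconnected_of_section (J := Ioi 1)
    (σ := fun P => |P| + |sumOf K L M P| + 2) ordConnected_Ioi ?_ ?_ ?_ ?_
  · have := continuousOn_sumOf (K := K) (M := M) (J := Ioi 1) h.L_pos.ne' fun P hP => ne_of_gt hP
    fun_prop
  · intro P hP
    have h1 := abs_nonneg P
    have h2 := abs_nonneg (sumOf K L M P)
    have hv : |P| ≤ |P| + |sumOf K L M P| + 2 := by linarith
    have hv0 : 0 < |P| + |sumOf K L M P| + 2 := by linarith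
    refine ⟨by linarith [h.a_lt_one, h.nu_lt_a], hv, ?_⟩
    rw [h.symH_neg_iff_upper hP hv0]
    linarith [(neg_one_le_div hv0 hv).1, le_abs_self (sumOf K L M P)]
  · rintro ⟨P, v⟩ ⟨h1, h2, h3⟩
    exact hP1 P v h1 h2 h3
  · refine fun P => ⟨?_⟩
    rintro u ⟨hu1, hu2, hu3⟩ - - v ⟨huv, -⟩
    dsimp only at hu1 hu2 hu3
    have hP := hP1 P u hu1 hu2 hu3
    have hu0 := hν.trans hu1
    refine ⟨hu1.trans_le huv, hu2.trans huv, ?_⟩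
    rw [h.symH_neg_iff_upper hP (hu0.trans_le huv)]
    rw [h.symH_neg_iff_upper hP hu0] at hu3
    have := le_abs_self P
    exact hu3.trans_le (add_div_le_add_div hu0 huv (by nlinarith))

theorem isPreconnected_upper_pos (h : CoeffBounds K L M a ν) :
    IsPreconnected {q : ℝ × ℝ | ν < q.2 ∧ |q.1| ≤ q.2 ∧ 0 < symH K L M (q.1 / q.2) q.2} := by
  have hν := h.nu_pos
  have hν1 : ν < 1 := h.nu_lt_a.trans h.a_lt_one
  have hML : 0 < M + L := add_pos h.M_pos h.L_pos
  -- For `P > 1` the section is the edge `x = 1`, where positivity is the condition defining `J`.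
  -- For `P ≤ 1` the whole slice is positive, and the condition holds automatically because `M + L`
  -- and `K + M` are positive.
  refine isPreconnected_of_section (J := {P | 0 < (K - L) * (max P 0) ^ 2 + M + L})
    (σ := fun P => max |P| 1) ?_ (by fun_prop) ?_ ?_ ?_
  · constructor
    rintro P hP Q hQ T ⟨hPT, hTQ⟩
    refine coeff_pos_of_sq_le hML ?_ hQ
    have h1 : max T 0 ≤ max Q 0 := max_le_max_right 0 hTQ
    have h2 : 0 ≤ max T 0 := le_max_right _ _
    nlinarith
  · intro P hc
    refine ⟨hν1.trans_le (le_max_right _ _), le_max_left _ _, ?_⟩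
    rcases le_or_gt P 1 with hP | hP
    · exact h.symH_pos_upper_of_le_one hP (hν1.le.trans (le_max_right _ _)) (le_max_left _ _)
    · have hP0 : 0 < P := by linarith
      simp only [mem_ofPred_eq, max_eq_left hP0.le] at hc
      rw [abs_of_pos hP0, max_eq_left hP.le]
      simp only [div_self hP0.ne']
      rwa [symH_one]
  · rintro ⟨P, v⟩ ⟨h1, h2, h3⟩
    dsimp only at h1 h2 h3
    show 0 < (K - L) * (max P 0) ^ 2 + M + L
    have hv0 := hν.trans h1
    rcases le_or_gt P 1 with hP | hP
    · refine coeff_pos_of_sq_le (Q := 1) hML ?_ (by linarith [h.K_add_M])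
      have h4 : 0 ≤ max P 0 := le_max_right _ _
      have h5 : max P 0 ≤ 1 := max_le hP (by norm_num)
      nlinarith
    · rw [max_eq_left (by linarith)]
      rw [h.symH_pos_iff_upper hP hv0] at h3
      have hPv : P ≤ v := (le_abs_self P).trans h2
      have h4 := add_div_le_add_div (P := P) (by linarith) hPv (by nlinarith)
      rw [div_self (by linarith)] at h4
      have h5 := h4.trans_lt h3
      rw [sumOf, lt_div_iff₀ (mul_pos h.L_pos (by linarith))] at h5
      linarith
  · refine fun P => ⟨?_⟩
    rintro u ⟨hu1, hu2, -⟩ v ⟨-, -, hv3⟩ t ⟨hut, htv⟩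
    dsimp only at hu1 hu2 hv3
    have ht := hu1.trans_le hut
    have ht0 := hν.trans ht
    have hPt := hu2.trans hut
    refine ⟨ht, hPt, ?_⟩
    dsimp only
    rcases le_or_gt P 1 with hP | hP
    · exact h.symH_pos_upper_of_le_one hP ht.le hPt
    · rw [h.symH_pos_iff_upper hP (ht0.trans_le htv)] at hv3
      rw [h.symH_pos_iff_upper hP ht0]
      have := le_abs_self P
      exact (add_div_le_add_div ht0 htv (by nlinarith)).trans_lt hv3

end CoeffBounds

end Regions

/-! ### The two curves: parametrization, ends, edges and complements. -/

/-- The zeros of `symH` with `x ∈ [-1, 1]` and `w = ν y < -a`. -/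
def lowerZeros (K L M a ν : ℝ) : Set (ℝ × ℝ) :=
  {p | p.1 ∈ Icc (-1 : ℝ) 1 ∧ ν * p.2 < -a ∧ symH K L M p.1 (ν * p.2) = 0}

/-- The zeros of `symH` with `x ∈ [-1, 1]` and `w = ν y > ν`. -/
def upperZeros (K L M ν : ℝ) : Set (ℝ × ℝ) :=
  {p | p.1 ∈ Icc (-1 : ℝ) 1 ∧ ν < ν * p.2 ∧ symH K L M p.1 (ν * p.2) = 0}

/-- The point of `lowerZeros` with `x w = P`. -/
noncomputable def lowerPoint (K L M ν P : ℝ) : ℝ × ℝ :=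
  ((sumOf K L M P + diffOf K L M P) / 2, (sumOf K L M P - diffOf K L M P) / 2 / ν)

/-- The point of `upperZeros` with `x w = P`. -/
noncomputable def upperPoint (K L M ν P : ℝ) : ℝ × ℝ :=
  ((sumOf K L M P - diffOf K L M P) / 2, (sumOf K L M P + diffOf K L M P) / 2 / ν)

section Curves

variable {K L M a ν C P : ℝ} {I : Set ℝ} {p : ℝ × ℝ}

theorem lowerPoint_sum (hν : ν ≠ 0) (P : ℝ) :
    (lowerPoint K L M ν P).1 + ν * (lowerPoint K L M ν P).2 = sumOf K L M P := by
  unfold lowerPoint; field_simp; ring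

theorem upperPoint_sum (hν : ν ≠ 0) (P : ℝ) :
    (upperPoint K L M ν P).1 + ν * (upperPoint K L M ν P).2 = sumOf K L M P := by
  unfold upperPoint; field_simp; ring

theorem lowerPoint_prod (h : CoeffBounds K L M a ν) (hP : P < 1) :
    (lowerPoint K L M ν P).1 * (ν * (lowerPoint K L M ν P).2) = P := by
  rw [lowerPoint, mul_div_cancel₀ _ h.nu_pos.ne']
  exact half_sum_mul_half_diff (h.disc_pos_lower hP).le

theorem upperPoint_prod (h : CoeffBounds K L M a ν) (hP : 1 < P)
    (hc : 0 ≤ (K - L) * P ^ 2 + M + L) :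
    (upperPoint K L M ν P).1 * (ν * (upperPoint K L M ν P).2) = P := by
  rw [upperPoint, mul_div_cancel₀ _ h.nu_pos.ne', mul_comm]
  exact half_sum_mul_half_diff ((sq_nonneg _).trans (CoeffBounds.disc_ge_upper h.L_pos hP hc))

theorem mem_lowerZeros_iff (h : CoeffBounds K L M a ν) : p ∈ lowerZeros K L M a ν ↔
    ∃ P < 1, 0 ≤ (K - L) * P ^ 2 + M + L ∧ lowerPoint K L M ν P = p := by
  refine (lower_zero_iff h).trans (exists_congr fun P => and_congr_right fun _ =>
    and_congr_right fun _ => ?_)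
  rw [Prod.ext_iff]
  simp only [lowerPoint, div_eq_iff h.nu_pos.ne']
  rw [eq_comm, mul_comm ν, eq_comm (a := p.2 * ν)]

theorem mem_upperZeros_iff (h : CoeffBounds K L M a ν) : p ∈ upperZeros K L M ν ↔
    ∃ P > 1, 0 ≤ (K - L) * P ^ 2 + M + L ∧ upperPoint K L M ν P = p := by
  refine (upper_zero_iff h).trans (exists_congr fun P => and_congr_right fun _ =>
    and_congr_right fun _ => ?_)
  rw [Prod.ext_iff]
  simp only [upperPoint, div_eq_iff h.nu_pos.ne']
  rw [eq_comm, mul_comm ν, eq_comm (a := p.2 * ν)]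

theorem isCurveParam_lower (h : CoeffBounds K L M a ν) (hC : C < 0) (hI : UniqueDiffOn ℝ I)
    (hcond : ∀ t ∈ I, 0 ≤ (K - L) * (1 + C * Real.exp t) ^ 2 + M + L)
    (hsurj : ∀ P < 1, 0 ≤ (K - L) * P ^ 2 + M + L → ∃ t ∈ I, 1 + C * Real.exp t = P) :
    IsCurveParam I (fun t => lowerPoint K L M ν (1 + C * Real.exp t)) (lowerZeros K L M a ν) := by
  have hlt : ∀ t, 1 + C * Real.exp t < 1 := fun t => by
    linarith [mul_neg_of_neg_of_pos hC (Real.exp_pos t)]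
  refine isCurveParam_of_mul_eq hI hC.ne (fun t _ => ?_) (fun t _ => lowerPoint_prod h (hlt t)) ?_
  · have h1 := contDiffAt_sumOf (K := K) (M := M) h.L_pos.ne' (hlt t).ne
    have h2 := contDiffAt_diffOf h.L_pos.ne' (hlt t).ne (h.disc_pos_lower (hlt t))
    have h3 : ContDiffAt ℝ ∞ (lowerPoint K L M ν) (1 + C * Real.exp t) :=
      ((h1.add h2).div_const 2).prodMk (((h1.sub h2).div_const 2).div_const ν)
    have h4 : ContDiffAt ℝ ∞ (fun t => 1 + C * Real.exp t) t := by fun_prop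
    exact (h3.comp t h4).contDiffWithinAt
  · ext p
    rw [mem_lowerZeros_iff h]
    constructor
    · rintro ⟨t, ht, rfl⟩
      exact ⟨_, hlt t, hcond t ht, rfl⟩
    · rintro ⟨P, hP, hc, rfl⟩
      obtain ⟨t, ht, rfl⟩ := hsurj P hP hc
      exact ⟨t, ht, rfl⟩

theorem isCurveParam_upper (h : CoeffBounds K L M a ν) (hC : 0 < C) (hI : UniqueDiffOn ℝ I)
    (hcond : ∀ t ∈ I, 0 ≤ (K - L) * (1 + C * Real.exp t) ^ 2 + M + L)
    (hsurj : ∀ P > 1, 0 ≤ (K - L) * P ^ 2 + M + L → ∃ t ∈ I, 1 + C * Real.exp t = P) :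
    IsCurveParam I (fun t => upperPoint K L M ν (1 + C * Real.exp t)) (upperZeros K L M ν) := by
  have hlt : ∀ t, 1 < 1 + C * Real.exp t := fun t => by
    linarith [mul_pos hC (Real.exp_pos t)]
  refine isCurveParam_of_mul_eq hI hC.ne' (fun t ht => ?_)
    (fun t ht => upperPoint_prod h (hlt t) (hcond t ht)) ?_
  · have h1 := contDiffAt_sumOf (K := K) (M := M) h.L_pos.ne' (hlt t).ne'
    have h2 := contDiffAt_diffOf h.L_pos.ne' (hlt t).ne'
      ((pow_pos (sub_pos.2 (hlt t)) 2).trans_le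
        (CoeffBounds.disc_ge_upper h.L_pos (hlt t) (hcond t ht)))
    have h3 : ContDiffAt ℝ ∞ (upperPoint K L M ν) (1 + C * Real.exp t) :=
      ((h1.sub h2).div_const 2).prodMk (((h1.add h2).div_const 2).div_const ν)
    have h4 : ContDiffAt ℝ ∞ (fun t => 1 + C * Real.exp t) t := by fun_prop
    exact (h3.comp t h4).contDiffWithinAt
  · ext p
    rw [mem_upperZeros_iff h]
    constructor
    · rintro ⟨t, ht, rfl⟩
      exact ⟨_, hlt t, hcond t ht, rfl⟩
    · rintro ⟨P, hP, hc, rfl⟩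
      obtain ⟨t, ht, rfl⟩ := hsurj P hP hc
      exact ⟨t, ht, rfl⟩

theorem abs_fst_le_of_mem_lower (hp : p ∈ lowerZeros K L M a ν) : |p.1| ≤ 1 := abs_le.2 hp.1

theorem abs_fst_le_of_mem_upper (hp : p ∈ upperZeros K L M ν) : |p.1| ≤ 1 := abs_le.2 hp.1

theorem tendsto_lower_atBot (h : CoeffBounds K L M a ν) (hC : C < 0)
    (hcond : ∀ᶠ t in atBot, 0 ≤ (K - L) * (1 + C * Real.exp t) ^ 2 + M + L) :
    Tendsto (fun t => lowerPoint K L M ν (1 + C * Real.exp t)) atBot (𝓝 0 ×ˢ atBot) := by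
  have hlt : ∀ t, 1 + C * Real.exp t < 1 := fun t => by
    linarith [mul_neg_of_neg_of_pos hC (Real.exp_pos t)]
  exact (tendsto_curve_atBot h.L_pos h.K_add_M h.nu_pos hC.ne
    (hcond.mono fun t ht =>
      abs_fst_le_of_mem_lower ((mem_lowerZeros_iff h).2 ⟨_, hlt t, ht, rfl⟩))
    (.of_forall fun t => lowerPoint_sum h.nu_pos.ne' _)
    (.of_forall fun t => lowerPoint_prod h (hlt t))).2 hC

theorem tendsto_upper_atBot (h : CoeffBounds K L M a ν) (hC : 0 < C)
    (hcond : ∀ᶠ t in atBot, 0 ≤ (K - L) * (1 + C * Real.exp t) ^ 2 + M + L) :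
    Tendsto (fun t => upperPoint K L M ν (1 + C * Real.exp t)) atBot (𝓝 0 ×ˢ atTop) := by
  have hlt : ∀ t, 1 < 1 + C * Real.exp t := fun t => by
    linarith [mul_pos hC (Real.exp_pos t)]
  exact (tendsto_curve_atBot h.L_pos h.K_add_M h.nu_pos hC.ne'
    (hcond.mono fun t ht =>
      abs_fst_le_of_mem_upper ((mem_upperZeros_iff h).2 ⟨_, hlt t, ht, rfl⟩))
    (.of_forall fun t => upperPoint_sum h.nu_pos.ne' _)
    (hcond.mono fun t ht => upperPoint_prod h (hlt t) ht)).1 hC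

theorem asymptotesToTwoLines_lower (h : CoeffBounds K L M a ν) (hKL : L ≤ K) :
    AsymptotesToTwoLines (lowerZeros K L M a ν) 0 (L / K) atBot := by
  have hcond : ∀ P, 0 ≤ (K - L) * P ^ 2 + M + L := fun P => by
    have := mul_nonneg (sub_nonneg.2 hKL) (sq_nonneg P)
    linarith [h.M_pos, h.L_pos]
  have hlt : ∀ t, 1 + (-1) * Real.exp t < 1 := fun t => by linarith [Real.exp_pos t]
  refine ⟨fun t => lowerPoint K L M ν (1 + (-1) * Real.exp t),
    isCurveParam_lower h (by norm_num) uniqueDiffOn_univ (fun t _ => hcond _) ?_,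
    tendsto_lower_atBot h (by norm_num) (.of_forall fun t => hcond _), ?_⟩
  · intro P hP _
    exact ⟨Real.log (1 - P), mem_univ _, by rw [Real.exp_log (by linarith)]; ring⟩
  · exact (tendsto_curve_atTop h.L_pos (h.L_pos.trans_le hKL) h.nu_pos (by norm_num : (-1 : ℝ) ≠ 0)
      (.of_forall fun t =>
        abs_fst_le_of_mem_lower ((mem_lowerZeros_iff h).2 ⟨_, hlt t, hcond _, rfl⟩))
      (.of_forall fun t => lowerPoint_sum h.nu_pos.ne' _)
      (.of_forall fun t => lowerPoint_prod h (hlt t))).2 (by norm_num)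

theorem asymptotesToTwoLines_upper (h : CoeffBounds K L M a ν) (hKL : L ≤ K) :
    AsymptotesToTwoLines (upperZeros K L M ν) 0 (L / K) atTop := by
  have hcond : ∀ P, 0 ≤ (K - L) * P ^ 2 + M + L := fun P => by
    have := mul_nonneg (sub_nonneg.2 hKL) (sq_nonneg P)
    linarith [h.M_pos, h.L_pos]
  have hlt : ∀ t, 1 < 1 + 1 * Real.exp t := fun t => by linarith [Real.exp_pos t]
  refine ⟨fun t => upperPoint K L M ν (1 + 1 * Real.exp t),
    isCurveParam_upper h (by norm_num) uniqueDiffOn_univ (fun t _ => hcond _) ?_,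
    tendsto_upper_atBot h (by norm_num) (.of_forall fun t => hcond _), ?_⟩
  · intro P hP _
    exact ⟨Real.log (P - 1), mem_univ _, by rw [Real.exp_log (by linarith)]; ring⟩
  · exact (tendsto_curve_atTop h.L_pos (h.L_pos.trans_le hKL) h.nu_pos (one_ne_zero (α := ℝ))
      (.of_forall fun t =>
        abs_fst_le_of_mem_upper ((mem_upperZeros_iff h).2 ⟨_, hlt t, hcond _, rfl⟩))
      (.of_forall fun t => upperPoint_sum h.nu_pos.ne' _)
      (.of_forall fun t => upperPoint_prod h (hlt t) (hcond _))).1 (by norm_num)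

/-- If `K < L`, the line `x = 1` meets the zeros of `symH` at `w = ± B` for some `B > 1`. -/
theorem exists_edge_zero (h : CoeffBounds K L M a ν) (hKL : K < L) :
    ∃ B : ℝ, 1 < B ∧ ∀ P, (K - L) * P ^ 2 + M + L = (L - K) * (B ^ 2 - P ^ 2) := by
  have h0 : 0 < L - K := by linarith
  have h1 : 1 < (M + L) / (L - K) := by
    rw [lt_div_iff₀ h0]; linarith [h.K_add_M]
  refine ⟨√((M + L) / (L - K)), Real.lt_sqrt_of_sq_lt (by linarith), fun P => ?_⟩
  rw [Real.sq_sqrt (by linarith)]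
  field_simp
  ring

theorem asymptotesToOneLine_lower (h : CoeffBounds K L M a ν) (hKL : K < L) :
    AsymptotesToOneLine (lowerZeros K L M a ν) 0 atBot := by
  obtain ⟨B, hB, hc⟩ := exists_edge_zero h hKL
  have h0 : 0 < L - K := by linarith
  -- The admissible products are `-B ≤ P < 1`; this constant puts the endpoint `P = -B`, where `x =
  -- 1`, at `t = 0`.
  have hC : -(1 + B) < 0 := by linarith
  have hcond : ∀ t ∈ Iic (0 : ℝ), 0 ≤ (K - L) * (1 + -(1 + B) * Real.exp t) ^ 2 + M + L := by
    intro t ht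
    have h1 : Real.exp t ≤ 1 := Real.exp_le_one_iff.2 ht
    have h2 := mul_neg_of_neg_of_pos hC (Real.exp_pos t)
    have h3 := mul_le_mul_of_nonpos_left h1 hC.le
    rw [hc]
    exact mul_nonneg h0.le (sub_nonneg.2 (sq_le_sq' (by linarith) (by linarith)))
  refine ⟨fun t => lowerPoint K L M ν (1 + -(1 + B) * Real.exp t),
    isCurveParam_lower h hC (uniqueDiffOn_Iic 0) hcond ?_,
    tendsto_lower_atBot h hC ((eventually_le_atBot 0).mono hcond)⟩
  intro P hP hPc
  rw [hc] at hPc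
  have h1 := nonneg_of_mul_nonneg_right hPc h0
  have h2 : -B ≤ P := (abs_le.1 (abs_le_of_sq_le_sq (by linarith) (by linarith))).1
  have h3 : 0 < (1 - P) / (1 + B) := div_pos (by linarith) (by linarith)
  refine ⟨Real.log ((1 - P) / (1 + B)), ?_, ?_⟩
  · exact Real.log_nonpos h3.le (by rw [div_le_one (by linarith)]; linarith)
  · rw [Real.exp_log h3]
    field_simp
    ring

theorem asymptotesToOneLine_upper (h : CoeffBounds K L M a ν) (hKL : K < L) :
    AsymptotesToOneLine (upperZeros K L M ν) 0 atTop := by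
  obtain ⟨B, hB, hc⟩ := exists_edge_zero h hKL
  have h0 : 0 < L - K := by linarith
  -- Now `1 < P ≤ B`, and `t = 0` corresponds to `P = B`.
  have hC : 0 < B - 1 := by linarith
  have hcond : ∀ t ∈ Iic (0 : ℝ), 0 ≤ (K - L) * (1 + (B - 1) * Real.exp t) ^ 2 + M + L := by
    intro t ht
    have h1 : Real.exp t ≤ 1 := Real.exp_le_one_iff.2 ht
    have h2 := mul_pos hC (Real.exp_pos t)
    have h3 := mul_le_mul_of_nonneg_left h1 hC.le
    rw [hc]
    exact mul_nonneg h0.le (sub_nonneg.2 (sq_le_sq' (by linarith) (by linarith)))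
  refine ⟨fun t => upperPoint K L M ν (1 + (B - 1) * Real.exp t),
    isCurveParam_upper h hC (uniqueDiffOn_Iic 0) hcond ?_,
    tendsto_upper_atBot h hC ((eventually_le_atBot 0).mono hcond)⟩
  intro P hP hPc
  rw [hc] at hPc
  have h1 := nonneg_of_mul_nonneg_right hPc h0
  have h2 : P ≤ B := (abs_le.1 (abs_le_of_sq_le_sq (by linarith) (by linarith))).2
  have h3 : 0 < (P - 1) / (B - 1) := div_pos (by linarith) hC
  refine ⟨Real.log ((P - 1) / (B - 1)), ?_, ?_⟩
  · exact Real.log_nonpos h3.le (by rw [div_le_one hC]; linarith)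
  · rw [Real.exp_log h3]
    field_simp
    ring

theorem AsymptotesToTwoLines.isConnectedCurve {γ : Set (ℝ × ℝ)} {u v : ℝ} {F : Filter ℝ}
    (h : AsymptotesToTwoLines γ u v F) : IsConnectedCurve γ :=
  let ⟨c, hc, _⟩ := h
  ⟨univ, c, ordConnected_univ, nontrivial_univ, hc⟩

theorem AsymptotesToOneLine.isConnectedCurve {γ : Set (ℝ × ℝ)} {u : ℝ} {F : Filter ℝ}
    (h : AsymptotesToOneLine γ u F) : IsConnectedCurve γ :=
  let ⟨c, hc, _⟩ := h
  ⟨Iic 0, c, ordConnected_Iic, ⟨0, by simp, -1, by simp, by norm_num⟩, hc⟩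

theorem isConnectedCurve_lower (h : CoeffBounds K L M a ν) :
    IsConnectedCurve (lowerZeros K L M a ν) :=
  (le_or_gt L K).elim (fun hKL => (asymptotesToTwoLines_lower h hKL).isConnectedCurve)
    fun hKL => (asymptotesToOneLine_lower h hKL).isConnectedCurve

theorem isConnectedCurve_upper (h : CoeffBounds K L M a ν) :
    IsConnectedCurve (upperZeros K L M ν) :=
  (le_or_gt L K).elim (fun hKL => (asymptotesToTwoLines_upper h hKL).isConnectedCurve)
    fun hKL => (asymptotesToOneLine_upper h hKL).isConnectedCurve

theorem staysAwayFrom_neg_one_lower (h : CoeffBounds K L M a ν) :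
    StaysAwayFrom (lowerZeros K L M a ν) (-1) := by
  refine ⟨1 - a, sub_pos.2 h.a_lt_one, fun p hp => ?_⟩
  have h1 := (h.lt_of_symH_eq_zero_lower hp.1 (by linarith [hp.2.1, h.nu_lt_a]) hp.2.2).2.2
  exact le_trans (by linarith) (le_abs_self _)

theorem staysAwayFrom_neg_one_upper (h : CoeffBounds K L M a ν) :
    StaysAwayFrom (upperZeros K L M ν) (-1) := by
  refine ⟨1, one_pos, fun p hp => ?_⟩
  have h1 : 0 < p.1 := by
    by_contra hx
    exact (h.symH_pos_upper_of_nonpos ⟨hp.1.1, not_lt.1 hx⟩ hp.2.1.le).ne' hp.2.2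
  exact le_trans (by linarith) (le_abs_self _)

/-- As a quadratic in `w`, `symH` has at `x = 1` the discriminant `-4 (K - L) (M + L) < 0`; by
continuity it has no real root for `x` near `1`. -/
theorem exists_symH_ne_zero_near_one (h : CoeffBounds K L M a ν) (hKL : L < K) :
    ∃ δ > 0, ∀ x w : ℝ, symH K L M x w = 0 → δ ≤ |x - 1| := by
  have h1 : ∀ᶠ x in 𝓝 (1 : ℝ),
      (L * (1 - x ^ 2)) ^ 2 - 4 * (x * (K * x - L)) * (M + L * x) < 0 := by
    refine ContinuousAt.eventually_lt (by fun_prop) (by fun_prop) ?_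
    have := mul_pos (sub_pos.2 hKL) (add_pos h.M_pos h.L_pos)
    linarith
  obtain ⟨δ, hδ, h2⟩ := Metric.eventually_nhds_iff.1 h1
  refine ⟨δ, hδ, fun x w h0 => ?_⟩
  by_contra hc
  have h3 := h2 (y := x) (by rw [Real.dist_eq]; exact not_le.1 hc)
  have h4 := sq_nonneg (2 * (x * (K * x - L)) * w + L * (1 - x ^ 2))
  unfold symH at h0
  have h5 : (2 * (x * (K * x - L)) * w + L * (1 - x ^ 2)) ^ 2 =
      (L * (1 - x ^ 2)) ^ 2 - 4 * (x * (K * x - L)) * (M + L * x) := by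
    linear_combination 4 * (x * (K * x - L)) * h0
  linarith

theorem existsUnique_lower (h : CoeffBounds K L M a ν) (hKL : K < L) :
    ∃! p, p ∈ lowerZeros K L M a ν ∧ p.1 = 1 := by
  obtain ⟨B, hB, hc⟩ := exists_edge_zero h hKL
  have hν := h.nu_pos
  have ha := h.a_pos
  refine ⟨(1, -B / ν), ⟨⟨by norm_num, ?_, ?_⟩, rfl⟩, ?_⟩
  · simp only [mul_div_cancel₀ _ hν.ne']; linarith [h.a_lt_one]
  · simp only [mul_div_cancel₀ _ hν.ne']
    rw [symH_one, hc]; ring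
  · rintro ⟨x, y⟩ ⟨⟨-, hw, h0⟩, rfl : x = 1⟩
    dsimp only at hw h0
    rw [symH_one, hc] at h0
    have h1 : (L - K) * (B - ν * y) * (B + ν * y) = 0 := by rw [← h0]; ring
    have h2 : B + ν * y = 0 :=
      (mul_eq_zero.1 h1).resolve_left (mul_pos (by linarith) (by linarith)).ne'
    rw [Prod.mk.injEq, eq_div_iff hν.ne']
    exact ⟨rfl, by linarith⟩

theorem existsUnique_upper (h : CoeffBounds K L M a ν) (hKL : K < L) :
    ∃! p, p ∈ upperZeros K L M ν ∧ p.1 = 1 := by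
  obtain ⟨B, hB, hc⟩ := exists_edge_zero h hKL
  have hν := h.nu_pos
  refine ⟨(1, B / ν), ⟨⟨by norm_num, ?_, ?_⟩, rfl⟩, ?_⟩
  · simp only [mul_div_cancel₀ _ hν.ne']; linarith [h.a_lt_one, h.nu_lt_a]
  · simp only [mul_div_cancel₀ _ hν.ne']
    rw [symH_one, hc]; ring
  · rintro ⟨x, y⟩ ⟨⟨-, hw, h0⟩, rfl : x = 1⟩
    dsimp only at hw h0
    rw [symH_one, hc] at h0
    have h1 : (L - K) * (B + ν * y) * (B - ν * y) = 0 := by rw [← h0]; ring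
    have h2 : B - ν * y = 0 :=
      (mul_eq_zero.1 h1).resolve_left (mul_pos (by linarith) (by linarith)).ne'
    rw [Prod.mk.injEq, eq_div_iff hν.ne']
    exact ⟨rfl, by linarith⟩

theorem continuous_symH (K L M ν : ℝ) :
    Continuous fun p : ℝ × ℝ => symH K L M p.1 (ν * p.2) := by
  unfold symH; fun_prop

/-- Points of the lower region in terms of `P = x w` and `v = -w`. -/
theorem lower_eq_image (h : CoeffBounds K L M a ν) (s : ℝ → Prop) :
    {p ∈ {p : ℝ × ℝ | p.1 ∈ Icc (-1 : ℝ) 1 ∧ ν * p.2 < -a} | s (symH K L M p.1 (ν * p.2))} =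
      (fun q : ℝ × ℝ => (-(q.1 / q.2), -q.2 / ν)) ''
        {q | a < q.2 ∧ |q.1| ≤ q.2 ∧ s (symH K L M (-(q.1 / q.2)) (-q.2))} := by
  have hν := h.nu_pos
  have ha := h.a_pos
  ext ⟨x, y⟩
  constructor
  · rintro ⟨⟨hx, hw⟩, hs⟩
    dsimp only at hx hw hs
    have hv : 0 < -(ν * y) := by linarith
    have hy : y ≠ 0 := by rintro rfl; simp at hv
    have h1 : -(x * (ν * y) / -(ν * y)) = x := by field_simp
    refine ⟨(x * (ν * y), -(ν * y)), ⟨by dsimp only; linarith, ?_, ?_⟩, ?_⟩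
    · dsimp only
      rw [abs_mul, abs_of_neg (by linarith : ν * y < 0)]
      exact mul_le_of_le_one_left hv.le (abs_le.2 hx)
    · dsimp only
      rwa [h1, neg_neg]
    · dsimp only
      rw [h1, neg_neg, mul_div_cancel_left₀ _ hν.ne']
  · rintro ⟨⟨P, v⟩, ⟨hv, hP, hs⟩, he⟩
    dsimp only at hv hP hs
    rw [Prod.mk.injEq] at he
    obtain ⟨rfl, rfl⟩ := he
    have h1 := neg_one_le_div (ha.trans hv) hP
    refine ⟨⟨⟨?_, ?_⟩, ?_⟩, ?_⟩ <;> dsimp only <;> try rw [mul_div_cancel₀ _ hν.ne']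
    · linarith
    · linarith
    · linarith
    · exact hs

/-- Points of the upper region in terms of `P = x w` and `w`. -/
theorem upper_eq_image (h : CoeffBounds K L M a ν) (s : ℝ → Prop) :
    {p ∈ {p : ℝ × ℝ | p.1 ∈ Icc (-1 : ℝ) 1 ∧ ν < ν * p.2} | s (symH K L M p.1 (ν * p.2))} =
      (fun q : ℝ × ℝ => (q.1 / q.2, q.2 / ν)) ''
        {q | ν < q.2 ∧ |q.1| ≤ q.2 ∧ s (symH K L M (q.1 / q.2) q.2)} := by
  have hν := h.nu_pos
  ext ⟨x, y⟩
  constructor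
  · rintro ⟨⟨hx, hw⟩, hs⟩
    dsimp only at hx hw hs
    have hv : 0 < ν * y := by linarith
    have h1 : x * (ν * y) / (ν * y) = x := mul_div_cancel_right₀ _ hv.ne'
    refine ⟨(x * (ν * y), ν * y), ⟨hw, ?_, ?_⟩, ?_⟩
    · dsimp only
      rw [abs_mul, abs_of_pos hv]
      exact mul_le_of_le_one_left hv.le (abs_le.2 hx)
    · dsimp only
      rwa [h1]
    · dsimp only
      rw [h1, mul_div_cancel_left₀ _ hν.ne']
  · rintro ⟨⟨P, v⟩, ⟨hv, hP, hs⟩, he⟩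
    dsimp only at hv hP hs
    rw [Prod.mk.injEq] at he
    obtain ⟨rfl, rfl⟩ := he
    have h1 := neg_one_le_div (hν.trans hv) hP
    refine ⟨⟨h1, ?_⟩, ?_⟩ <;> dsimp only <;> rwa [mul_div_cancel₀ _ hν.ne']

theorem separatesInTwo_lower (h : CoeffBounds K L M a ν) :
    SeparatesInTwo (lowerZeros K L M a ν)
      {p : ℝ × ℝ | p.1 ∈ Icc (-1 : ℝ) 1 ∧ ν * p.2 < -a} := by
  have hν := h.nu_pos
  have ha := h.a_pos
  have he : lowerZeros K L M a ν = {p ∈ {p : ℝ × ℝ | p.1 ∈ Icc (-1 : ℝ) 1 ∧ ν * p.2 < -a} |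
      symH K L M p.1 (ν * p.2) = 0} := by
    ext p; exact and_assoc.symm
  have hcont : ∀ U : Set (ℝ × ℝ), (∀ q ∈ U, a < q.2) →
      ContinuousOn (fun q : ℝ × ℝ => (-(q.1 / q.2), -q.2 / ν)) U := fun U hU =>
    (continuousOn_fst.div continuousOn_snd fun q hq => (ha.trans (hU q hq)).ne').neg.prodMk
      (continuousOn_snd.neg.div_const ν)
  rw [he]
  -- The positive witness lies on `x = -1`; the negative one on `x = 0`, where `symH` is `M + L w`,
  -- at the `w` giving the value `-L`.
  refine separatesInTwo_of_sign (continuous_symH K L M ν) ⟨⟨(-1, -1 / ν), ?_⟩, ?_⟩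
    ⟨⟨(0, (-(M / L) - 1) / ν), ?_⟩, ?_⟩
  · refine ⟨⟨by norm_num, ?_⟩, ?_⟩ <;> dsimp only <;> rw [mul_div_cancel₀ _ hν.ne']
    · linarith [h.a_lt_one]
    · rw [symH_neg_one]; linarith [h.K_add_M]
  · rw [lower_eq_image h (fun r => 0 < r)]
    exact h.isPreconnected_lower_pos.image _ (hcont _ fun q hq => hq.1)
  · have hML := div_pos h.M_pos h.L_pos
    have hL := h.L_pos
    refine ⟨⟨by norm_num, ?_⟩, ?_⟩ <;> dsimp only <;> rw [mul_div_cancel₀ _ hν.ne']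
    · linarith [h.a_lt_one]
    · have : symH K L M 0 (-(M / L) - 1) = -L := by unfold symH; field_simp; ring
      rw [this]; linarith
  · rw [lower_eq_image h (fun r => r < 0)]
    exact h.isPreconnected_lower_neg.image _ (hcont _ fun q hq => hq.1)

theorem separatesInTwo_upper (h : CoeffBounds K L M a ν) :
    SeparatesInTwo (upperZeros K L M ν)
      {p : ℝ × ℝ | p.1 ∈ Icc (-1 : ℝ) 1 ∧ ν < ν * p.2} := by
  have hν := h.nu_pos
  have he : upperZeros K L M ν = {p ∈ {p : ℝ × ℝ | p.1 ∈ Icc (-1 : ℝ) 1 ∧ ν < ν * p.2} |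
      symH K L M p.1 (ν * p.2) = 0} := by
    ext p; exact and_assoc.symm
  have hcont : ∀ U : Set (ℝ × ℝ), (∀ q ∈ U, ν < q.2) →
      ContinuousOn (fun q : ℝ × ℝ => (q.1 / q.2, q.2 / ν)) U := fun U hU =>
    (continuousOn_fst.div continuousOn_snd fun q hq => (hν.trans (hU q hq)).ne').prodMk
      (continuousOn_snd.div_const ν)
  rw [he]
  refine separatesInTwo_of_sign (continuous_symH K L M ν) ⟨⟨(-1, 1 / ν), ?_⟩, ?_⟩ ⟨?_, ?_⟩
  · refine ⟨⟨by norm_num, ?_⟩, ?_⟩ <;> dsimp only <;> rw [mul_div_cancel₀ _ hν.ne']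
    · linarith [h.a_lt_one, h.nu_lt_a]
    · rw [symH_neg_one]; linarith [h.K_add_M]
  · rw [upper_eq_image h (fun r => 0 < r)]
    exact h.isPreconnected_upper_pos.image _ (hcont _ fun q hq => hq.1)
  · rw [upper_eq_image h (fun r => r < 0)]
    have h1 := abs_nonneg (sumOf K L M 2)
    have h2 := le_abs_self (sumOf K L M 2)
    have hv : 0 < |sumOf K L M 2| + 2 := by linarith
    refine Nonempty.image _ ⟨(2, |sumOf K L M 2| + 2), ?_, ?_, ?_⟩ <;> dsimp only
    · linarith [h.a_lt_one, h.nu_lt_a]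
    · rw [abs_of_pos two_pos]; linarith
    · rw [h.symH_neg_iff_upper one_lt_two hv]
      linarith [div_pos two_pos hv]
  · rw [upper_eq_image h (fun r => r < 0)]
    exact h.isPreconnected_upper_neg.image _ (hcont _ fun q hq => hq.1)

end Curves

end PomeranskySenkov

/-! ### Assembly of the three cases. -/

open PomeranskySenkov in
theorem mainTheorem3 (ν l : ℝ) (h : Admissible ν l) :
    ∃ γm γp : Set (ℝ × ℝ),
      Sing ν l ∩ {p | p.2 ∉ Ioo (-1) 1} = γp ∪ γm ∧
      IsConnectedCurve γm ∧ IsConnectedCurve γp ∧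
      SeparatesInTwo γm (lowerRegion ν l) ∧ SeparatesInTwo γp upperRegion ∧
      (l + ν < 1 →
        (StaysAwayFrom γm (-1) ∧ StaysAwayFrom γm 1 ∧
          AsymptotesToTwoLines γm 0 (xStar ν l) atBot) ∧
        (StaysAwayFrom γp (-1) ∧ StaysAwayFrom γp 1 ∧
          AsymptotesToTwoLines γp 0 (xStar ν l) atTop)) ∧
      (1 < l + ν →
        ((∃! p, p ∈ γm ∧ p.1 = 1) ∧ StaysAwayFrom γm (-1) ∧ AsymptotesToOneLine γm 0 atBot) ∧
        ((∃! p, p ∈ γp ∧ p.1 = 1) ∧ StaysAwayFrom γp (-1) ∧ AsymptotesToOneLine γp 0 atTop)) ∧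
      (l + ν = 1 →
        (StaysAwayFrom γm (-1) ∧ AsymptotesToTwoLines γm 0 1 atBot ∧ ∀ p ∈ γm, p.1 ≠ 1) ∧
        (StaysAwayFrom γp (-1) ∧ AsymptotesToTwoLines γp 0 1 atTop ∧ ∀ p ∈ γp, p.1 ≠ 1)) := by
  obtain ⟨a, b, hb, hba, ha1, hab, hl, hyc⟩ := exists_roots h
  have hν := h.1
  have hB := coeffBounds_of_roots hb hba ha1 hab hl
  have hH := nu_mul_H ν l
  have hKL : 1 - l ^ 2 - ν ^ 2 - 2 * l * ν = (1 - (l + ν)) * (1 + (l + ν)) := by ring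
  have hx : xStar ν l = 2 * l * ν / (1 - l ^ 2 - ν ^ 2) := by
    rw [xStar, neg_div, ← div_neg]; congr 1; ring
  set K := 1 - l ^ 2 - ν ^ 2
  set L := 2 * l * ν
  set M := ν * (1 + l ^ 2 - ν ^ 2)
  have hlν : 0 < 1 + (l + ν) := by linarith
  have hlow : lowerRegion ν l = {p : ℝ × ℝ | p.1 ∈ Icc (-1 : ℝ) 1 ∧ ν * p.2 < -a} := by
    ext p
    refine and_congr_right fun _ => ?_
    rw [mem_Iio, ← hyc, mul_lt_mul_iff_right₀ hν]
  have hupp : upperRegion = {p : ℝ × ℝ | p.1 ∈ Icc (-1 : ℝ) 1 ∧ ν < ν * p.2} := by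
    ext p
    refine and_congr_right fun _ => ?_
    rw [mem_Ioi, lt_mul_iff_one_lt_right hν]
  have hzero : ∀ p : ℝ × ℝ, H ν l p.1 p.2 = 0 ↔ symH K L M p.1 (ν * p.2) = 0 := fun p => by
    rw [← hH, mul_eq_zero, or_iff_right hν.ne']
  refine ⟨lowerZeros K L M a ν, upperZeros K L M ν, ?_, isConnectedCurve_lower hB,
    isConnectedCurve_upper hB, hlow ▸ separatesInTwo_lower hB, hupp ▸ separatesInTwo_upper hB,
    ?_, ?_, ?_⟩
  · have hν1 : ν < 1 := h.2.1
    ext p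
    constructor
    · rintro ⟨⟨hp, h0⟩, hy⟩
      rw [hzero] at h0
      rcases le_or_gt p.2 (-1) with h1 | h1
      -- This covers the band `y_c ≤ y ≤ -1` too: zeros with `w ≤ -ν` already have `w < -a`.
      · have h2 : ν * p.2 ≤ -ν := by nlinarith
        exact Or.inr ⟨hp, (hB.lt_of_symH_eq_zero_lower hp h2 h0).2.1, h0⟩
      · have h2 : 1 ≤ p.2 := by
          by_contra hc
          exact hy ⟨h1, not_le.1 hc⟩
        rcases h2.eq_or_lt with h3 | h3
        · rw [← h3, mul_one] at h0
          have := hB.symH_pos_upper hp le_rfl (by nlinarith [hp.1, hp.2])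
          linarith
        · exact Or.inl ⟨hp, by nlinarith, h0⟩
    · rintro (⟨hp, hw, h0⟩ | ⟨hp, hw, h0⟩)
      · refine ⟨⟨hp, (hzero p).2 h0⟩, fun hy => ?_⟩
        nlinarith [hy.2]
      · refine ⟨⟨hp, (hzero p).2 h0⟩, fun hy => ?_⟩
        nlinarith [hy.1, hB.nu_lt_a]
  · intro hc
    have hKL' : L < K := sub_pos.1 (hKL ▸ mul_pos (by linarith) hlν)
    obtain ⟨δ, hδ, hδ'⟩ := exists_symH_ne_zero_near_one hB hKL'
    rw [hx]
    exact ⟨⟨staysAwayFrom_neg_one_lower hB, ⟨δ, hδ, fun p hp => hδ' _ _ hp.2.2⟩,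
      asymptotesToTwoLines_lower hB hKL'.le⟩, staysAwayFrom_neg_one_upper hB,
      ⟨δ, hδ, fun p hp => hδ' _ _ hp.2.2⟩, asymptotesToTwoLines_upper hB hKL'.le⟩
  · intro hc
    have hKL' : K < L := sub_neg.1 (hKL ▸ mul_neg_of_neg_of_pos (by linarith) hlν)
    exact ⟨⟨existsUnique_lower hB hKL', staysAwayFrom_neg_one_lower hB,
      asymptotesToOneLine_lower hB hKL'⟩, existsUnique_upper hB hKL',
      staysAwayFrom_neg_one_upper hB, asymptotesToOneLine_upper hB hKL'⟩
  · intro hc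
    have hKL' : K = L := by rw [hc] at hKL; linarith
    have hdiv : L / K = 1 := by rw [hKL', div_self hB.L_pos.ne']
    have hne : ∀ w, symH K L M 1 w ≠ 0 := fun w => by
      rw [symH_one, hKL']
      have := add_pos hB.M_pos hB.L_pos
      linarith
    have hlo := asymptotesToTwoLines_lower hB hKL'.ge
    have hup := asymptotesToTwoLines_upper hB hKL'.ge
    rw [hdiv] at hlo hup
    exact ⟨⟨staysAwayFrom_neg_one_lower hB, hlo, fun p hp h1 => hne _ (h1 ▸ hp.2.2)⟩,
      staysAwayFrom_neg_one_upper hB, hup, fun p hp h1 => hne _ (h1 ▸ hp.2.2)⟩
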